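/- Let $(\mathcal M,\mathfrak g)$ be a finite-dimensional, geodesically complete smooth Riemannian manifold. For $x\in\mathcal M$ and $v\in T_x\mathcal M$ with $y=\mathrm{Exp}_x(v)$, let $\Gamma_x^y$ denote parallel transport (for the Levi-Civita connection) along the geodesic $t\mapsto \mathrm{Exp}_x(tv)$, $t\in[0,1]$, from $x$ to $y$. Consider the online problem $\min_{x\in\mathcal M} f(x)$, $f(x)=\mathbb E_{\xi\sim\mathcal D}[f(x,\xi)]$, with $f$ differentiable, and assume: * (geodesic $L$-smoothness, $L>0$) for every $\xi$, $f(\cdot,\xi)$ is differentiable and $\|\nabla f(x,\xi)-\Gamma_y^x\nabla f(y,\xi)\|\le L\|v\|$ for all $x$, $v\in T_x\mathcal M$, $y=\mathrm{Exp}_x(v)$, where $\Gamma_y^x=(\Gamma_x^y)^{-1}$; * (unbiasedness) $\mathbb E_{\xi}[\nabla f(x,\xi)]=\nabla f(x)$ for all $x$; * (bounded variance, $\sigma>0$) $\mathbb E_{\xi}\|\nabla f(x,\xi)-\nabla f(x)\|^2\le\sigma^2$ for all $x$; * (lower bound) $f(x)\ge f^*$ for all $x$. For i.i.d. samples $\xi_1,\dots,\xi_m\sim\mathcal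 D$ put $\nabla f_m(x)=\frac1m\sum_{i=1}^m\nabla f(x,\xi_i)$. R-PAGE started at $x^0\in\mathcal M$ computes $g^0=\nabla f_B(x^0)$ and, for $k=0,1,2,\dots$, $x^{k+1}=\mathrm{Exp}_{x^k}(-\eta g^k)$ and, with fresh samples and an independent coin, $$g^{k+1}=\begin{cases}\nabla f_B(x^{k+1}) & \text{with probability } p,\\ \Gamma_{x^k}^{x^{k+1}}(g^k)+\nabla f_b(x^{k+1})-\Gamma_{x^k}^{x^{k+1}}\big(\nabla f_b(x^k)\big) & \text{with probability } 1-p,\end{cases}$$ where the same $b$ samples are used at $x^{k+1}$ and at $x^k$. Let $\delta^0=f(x^0)-f^*$ and $\varepsilon>0$, and choose $$B=\Big\lceil\tfrac{2\sigma^2}{\varepsilon^2}\Big\rceil,\quad b\in\mathbb N,\ 1\le b\le\sqrt B,\quad p=\frac{b}{B+b},\quad \eta=\frac{1}{L\big(1+\sqrt{\frac{1-p}{pb}}\big)},\quad K=\Big\lceil\frac{4\delta^0}{\varepsilon^2\eta}+\frac1p\Big\rceil .$$ Let $\widehat x^K$ be chosen uniformly at random from $x^0,\dots,x^{K-1}$.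 Then $\widehat x^K$ is an $\varepsilon$-stationary point in expectation: $$\mathbb E\|\nabla f(\widehat x^K)\|^2\le\varepsilon^2,\qquad\text{and}\qquad \mathbb E\|\nabla f(\widehat x^K)\|\le\varepsilon .$$ Moreover, if $\varepsilon\le\sigma$, the expected number $\#\mathrm{grad}$ of stochastic gradients $\nabla f(x,\xi)$ computed in the initialization and these $K$ iterations ($B$ for $g^0$; in each iteration $B$ in the first case and $2b$ in the second) satisfies $$\mathbb E[\#\mathrm{grad}]\le 50\Big(\frac{\sigma^2}{\varepsilon^2}+\frac{L\delta^0\sigma}{\varepsilon^3}\Big),$$ that is, $\#\mathrm{grad}=\mathcal O\big(\frac{\sigma^2}{\varepsilon^2}+\frac{\sigma}{\varepsilon^3}\big)$ with a constant that depends only on $L\delta^0$. -/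

import Mathlib

open Bundle MeasureTheory
open scoped Manifold ContDiff

noncomputable section

namespace RPAGE

section Geometry

variable {E : Type*} [NormedAddCommGroup E] [NormedSpace ℝ E]
  {M : Type*} [TopologicalSpace M] [ChartedSpace E M] [IsManifold 𝓘(ℝ, E) ∞ M]
  [RiemannianBundle (fun x : M => TangentSpace 𝓘(ℝ, E) x)]

/-- The coefficient `g_y(a, b)` of the Riemannian metric in the chart centred at `x₀`: the inner
product of the two tangent vectors which have coordinates `a` and `b` in this chart, at the point
with coordinates `y`. -/
def metricCoeff (x₀ : M) (y a b : E) : ℝ :=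
  inner ℝ
    ((trivializationAt E (fun x : M => TangentSpace 𝓘(ℝ, E) x) x₀).symmL ℝ
      ((extChartAt 𝓘(ℝ, E) x₀).symm y) a)
    ((trivializationAt E (fun x : M => TangentSpace 𝓘(ℝ, E) x) x₀).symmL ℝ
      ((extChartAt 𝓘(ℝ, E) x₀).symm y) b)

/-- A vector field `V` along the curve `γ` is parallel for the Levi-Civita connection.
At time `t`, let `u` and `v` be the coordinates of `γ` and `V` in the chart centred at `γ t`.
The equation `v' + Γ_u(u', v) = 0` is paired with an arbitrary vector `a`, and the Christoffel
symbols are written out in terms of the metric: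
`2 g(Γ(u', v), a) = D_{u'} g(v, a) + D_v g(u', a) - D_a g(u', v)`. -/
def IsParallelAlong (γ : ℝ → M) (V : ∀ t, TangentSpace 𝓘(ℝ, E) (γ t)) : Prop :=
  MDifferentiable 𝓘(ℝ, ℝ) 𝓘(ℝ, E).tangent (fun t => (⟨γ t, V t⟩ : TangentBundle 𝓘(ℝ, E) M)) ∧
  ∀ (t : ℝ) (a : E),
    let u : ℝ → E := fun s => extChartAt 𝓘(ℝ, E) (γ t) (γ s)
    let v : ℝ → E := fun s =>
      (trivializationAt E (fun x : M => TangentSpace 𝓘(ℝ, E) x) (γ t)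
        (⟨γ s, V s⟩ : TangentBundle 𝓘(ℝ, E) M)).2
    2 * metricCoeff (γ t) (u t) (deriv v t) a
      + fderiv ℝ (fun y => metricCoeff (γ t) y (v t) a) (u t) (deriv u t)
      + fderiv ℝ (fun y => metricCoeff (γ t) y (deriv u t) a) (u t) (v t)
      - fderiv ℝ (fun y => metricCoeff (γ t) y (deriv u t) (v t)) (u t) a = 0

/-- The velocity `γ'(t)` of a curve. -/
def velocity (γ : ℝ → M) (t : ℝ) : TangentSpace 𝓘(ℝ, E) (γ t) :=
  mfderiv 𝓘(ℝ, ℝ) 𝓘(ℝ, E) γ t (1 : ℝ)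

/-- Geodesics: curves whose velocity is parallel along them. -/
def IsGeodesic (γ : ℝ → M) : Prop := IsParallelAlong γ (fun t => velocity (E := E) γ t)

/-- `γ` is a geodesic defined for all times whose initial point and initial velocity are given by
the tangent vector `v`. -/
def IsGeodesicFrom (v : TangentBundle 𝓘(ℝ, E) M) (γ : ℝ → M) : Prop :=
  IsGeodesic (E := E) γ ∧ (⟨γ 0, velocity γ 0⟩ : TangentBundle 𝓘(ℝ, E) M) = v

variable (E M) in
/-- Geodesic completeness: the exponential map is defined on the whole tangent bundle. -/
def GeodesicallyComplete : Prop :=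
  ∀ v : TangentBundle 𝓘(ℝ, E) M, ∃ γ : ℝ → M, IsGeodesicFrom v γ

open Classical in
/-- The geodesic with initial velocity `v` (a constant curve if there is none). -/
def geodesic (v : TangentBundle 𝓘(ℝ, E) M) : ℝ → M :=
  if h : ∃ γ : ℝ → M, IsGeodesicFrom v γ then h.choose else fun _ => v.proj

/-- The Riemannian exponential map. -/
def expMap (v : TangentBundle 𝓘(ℝ, E) M) : M := geodesic v 1

/-- `w'` is the parallel transport of `w` along `γ` from time `a` to time `b`. -/
def IsParallelTransport (γ : ℝ → M) (a b : ℝ) (w : TangentSpace 𝓘(ℝ, E) (γ a))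
    (w' : TangentSpace 𝓘(ℝ, E) (γ b)) : Prop :=
  ∃ V : ∀ t, TangentSpace 𝓘(ℝ, E) (γ t), IsParallelAlong γ V ∧ V a = w ∧ V b = w'

open Classical in
/-- `transport v w` is the parallel transport of `w ∈ T_x M` to `T_y M`, `y = Exp_x v`, along the
geodesic `t ↦ Exp_x (t v)`, `0 ≤ t ≤ 1`; here `x` is the base point of `v`. -/
def transport (v : TangentBundle 𝓘(ℝ, E) M) (w : TangentSpace 𝓘(ℝ, E) v.proj) :
    TangentSpace 𝓘(ℝ, E) (expMap v) :=
  if h : ∃ V : ∀ t, TangentSpace 𝓘(ℝ, E) (geodesic v t), IsParallelAlong (geodesic v) V ∧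
      (⟨geodesic v 0, V 0⟩ : TangentBundle 𝓘(ℝ, E) M) = ⟨v.proj, w⟩
  then h.choose 1 else 0

variable [FiniteDimensional ℝ E]

/-- The Riemannian gradient: `⟨∇f(x), w⟩ = df(x) w` for all `w ∈ T_x M`. -/
def grad (f : M → ℝ) (x : M) : TangentSpace 𝓘(ℝ, E) x :=
  haveI : FiniteDimensional ℝ (TangentSpace 𝓘(ℝ, E) x) := inferInstanceAs (FiniteDimensional ℝ E)
  haveI : CompleteSpace (TangentSpace 𝓘(ℝ, E) x) := FiniteDimensional.complete ℝ _
  (InnerProductSpace.toDual ℝ (TangentSpace 𝓘(ℝ, E) x)).symm (mvfderiv 𝓘(ℝ, E) f x)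

variable (E) in
/-- A geodesically `L`-smooth function: for each geodesic `γ` from `x = γ 0` to `y = γ 1`, so that
`γ'(0)` is `Exp_x⁻¹ y`, one has `‖∇f(x) - Γ_y^x ∇f(y)‖ ≤ L ‖Exp_x⁻¹ y‖`, with `Γ_y^x` the parallel
transport along `γ`. -/
def IsGeodesicallySmooth (L : ℝ) (f : M → ℝ) : Prop :=
  MDifferentiable 𝓘(ℝ, E) 𝓘(ℝ, ℝ) f ∧
  ∀ γ : ℝ → M, IsGeodesic (E := E) γ →
    ∃ w : TangentSpace 𝓘(ℝ, E) (γ 0), IsParallelTransport γ 1 0 (grad f (γ 1)) w ∧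
      ‖grad f (γ 0) - w‖ ≤ L * ‖velocity (E := E) γ 0‖

/-! ### The algorithm -/

variable {Ξ : Type*}

variable (E) in
/-- The minibatch stochastic gradient at `x` for the samples `ξ₁, …, ξ_m`. -/
def batchGrad (F : M → Ξ → ℝ) {m : ℕ} (ξ : Fin m → Ξ) (x : M) : TangentSpace 𝓘(ℝ, E) x :=
  (m : ℝ)⁻¹ • ∑ i, grad (fun y => F y (ξ i)) x

/-- The randomness of one iteration: the coin (`true` has probability `p`), the large minibatch and
the small minibatch. -/
abbrev StepSample (Ξ : Type*) (B b : ℕ) : Type _ := Bool × (Fin B → Ξ) × (Fin b → Ξ)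

/-- One iteration of R-PAGE, mapping the pair `(x^k, g^k)`, a tangent vector, to
`(x^{k+1}, g^{k+1})`. -/
def step (F : M → Ξ → ℝ) (η : ℝ) {B b : ℕ} (z : TangentBundle 𝓘(ℝ, E) M)
    (s : StepSample Ξ B b) : TangentBundle 𝓘(ℝ, E) M :=
  let v : TangentBundle 𝓘(ℝ, E) M := ⟨z.proj, -(η • z.snd)⟩
  ⟨expMap v,
    if s.1 = true then batchGrad E F s.2.1 (expMap v)
    else transport v z.snd + batchGrad E F s.2.2 (expMap v)
      - transport v (batchGrad E F s.2.2 z.proj)⟩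

/-- The iterates `(x^0, g^0), …, (x^K, g^K)` of R-PAGE started at `x₀`, as a function of the initial
minibatch `r.1` and of the randomness `r.2` of the `K` iterations. -/
def iterates (F : M → Ξ → ℝ) (η : ℝ) (x₀ : M) {B b K : ℕ}
    (r : (Fin B → Ξ) × (Fin K → StepSample Ξ B b)) : Fin (K + 1) → TangentBundle 𝓘(ℝ, E) M :=
  Fin.induction (motive := fun _ => TangentBundle 𝓘(ℝ, E) M)
    ⟨x₀, batchGrad E F r.1 x₀⟩ (fun k z => step F η z (r.2 k))

end Geometry

section Probability

variable {Ξ : Type*} [MeasurableSpace Ξ]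

/-- The law of the randomness of one iteration: a coin with success probability `p` and two
minibatches of independent samples from `D`, all independent. -/
def stepLaw (D : Measure Ξ) (B b : ℕ) (p : ℝ) : Measure (StepSample Ξ B b) :=
  (ENNReal.ofReal p • Measure.dirac true + ENNReal.ofReal (1 - p) • Measure.dirac false).prod
    ((Measure.pi fun _ => D).prod (Measure.pi fun _ => D))

/-- The law of the whole randomness of `K` iterations of R-PAGE. -/
def runLaw (D : Measure Ξ) (B b : ℕ) (p : ℝ) (K : ℕ) :
    Measure ((Fin B → Ξ) × (Fin K → StepSample Ξ B b)) :=
  (Measure.pi fun _ => D).prod (Measure.pi fun _ => stepLaw D B b p)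

/-- The number of stochastic gradients `∇f(x, ξ)` computed in `K` iterations: `B` for `g^0`, and for
each iteration `B` if the coin shows `true`, and otherwise `2 b`, as each of the `b` samples is
evaluated both at `x^{k+1}` and at `x^k`. -/
def gradCount {B b K : ℕ} (r : (Fin B → Ξ) × (Fin K → StepSample Ξ B b)) : ℕ :=
  B + ∑ k, if (r.2 k).1 = true then B else 2 * b

end Probability

end RPAGE

end

/-!
Parallel transport along a geodesic is a linear isometry, so the recursive estimator of R-PAGE can
be compared with the gradient within one tangent space: given the past, its squared error
`‖g - ∇f(x)‖²` becomes in expectation at most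
`(1 - p) (‖g - ∇f(x)‖² + L² η² ‖g‖² / b) + p σ² / B`. Integrating the gradient along geodesics shows
that `f` is bounded above by its quadratic model with constant `L`. With the step size `η`, the two
estimates combine to the decrease of the Lyapunov function `f(x) - f* + η / (2 p) ‖g - ∇f(x)‖²` by
at least `η / 2 ‖∇f(x)‖²` in expectation in each iteration, up to an error `η σ² / (2 B)`; summing
over the iterations bounds the mean of `‖∇f(x)‖²`.

The iterates need not be measurable functions of the samples, so expectations are lower integrals
and the inequality `lintegral_prod_le` takes the place of Tonelli's theorem.
-/

noncomputable section

namespace RPAGE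

section MetricCoefficients

variable {E : Type*} [NormedAddCommGroup E] [NormedSpace ℝ E]
  {M : Type*} [TopologicalSpace M] [ChartedSpace E M] [IsManifold 𝓘(ℝ, E) ∞ M]

lemma mdifferentiableAt_symmL (x₀ : M) {N : Type*} [NormedAddCommGroup N] [NormedSpace ℝ N]
    {φ ψ : N → E} {n : N} (hφ : DifferentiableAt ℝ φ n) (hψ : DifferentiableAt ℝ ψ n)
    (hn : φ n ∈ (extChartAt 𝓘(ℝ, E) x₀).target) :
    MDifferentiableAt 𝓘(ℝ, N) 𝓘(ℝ, E).tangent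
      (fun q : N => (⟨(extChartAt 𝓘(ℝ, E) x₀).symm (φ q),
        (trivializationAt E (fun x : M => TangentSpace 𝓘(ℝ, E) x) x₀).symmL ℝ
          ((extChartAt 𝓘(ℝ, E) x₀).symm (φ q)) (ψ q)⟩ : TangentBundle 𝓘(ℝ, E) M)) n := by
  have hsymm : MDifferentiableAt 𝓘(ℝ, E) 𝓘(ℝ, E) (extChartAt 𝓘(ℝ, E) x₀).symm (φ n) :=
    ((contMDiffOn_extChartAt_symm (n := ∞) x₀).contMDiffAt
      ((isOpen_extChartAt_target x₀).mem_nhds hn)).mdifferentiableAt (by simp)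
  have hbase : MDifferentiableAt 𝓘(ℝ, N) 𝓘(ℝ, E)
      (fun q : N => (extChartAt 𝓘(ℝ, E) x₀).symm (φ q)) n :=
    hsymm.comp n hφ.mdifferentiableAt
  have hmem : (extChartAt 𝓘(ℝ, E) x₀).symm (φ n) ∈
      (trivializationAt E (fun x : M => TangentSpace 𝓘(ℝ, E) x) x₀).baseSet := by
    have := (extChartAt 𝓘(ℝ, E) x₀).map_target hn
    rwa [extChartAt_source] at this
  have hev := hbase.continuousAt.preimage_mem_nhds
    ((trivializationAt E (fun x : M => TangentSpace 𝓘(ℝ, E) x) x₀).open_baseSet.mem_nhds hmem)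
  refine (Trivialization.mdifferentiableAt_totalSpace_iff 𝓘(ℝ, E)
    (trivializationAt E (fun x : M => TangentSpace 𝓘(ℝ, E) x) x₀) _
    ((Trivialization.mem_source _).2 hmem)).2
      ⟨hbase, hψ.mdifferentiableAt.congr_of_eventuallyEq ?_⟩
  filter_upwards [hev] with q hq
  rw [← Trivialization.continuousLinearMapAt_apply_of_mem (R := ℝ) _ hq,
    Trivialization.continuousLinearMapAt_symmL _ hq]

lemma hasDerivAt_of_hasDerivAt_partial {A B G : Type*} [NormedAddCommGroup A] [NormedSpace ℝ A]
    [NormedAddCommGroup B] [NormedSpace ℝ B] [NormedAddCommGroup G] [NormedSpace ℝ G]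
    {Φ : A × B → G} {a : ℝ → A} {b : ℝ → B} {a' : A} {b' : B} {p q : G} {t : ℝ}
    (hΦ : DifferentiableAt ℝ Φ (a t, b t)) (ha : HasDerivAt a a' t) (hb : HasDerivAt b b' t)
    (hp : HasDerivAt (fun s => Φ (a s, b t)) p t) (hq : HasDerivAt (fun s => Φ (a t, b s)) q t) :
    HasDerivAt (fun s => Φ (a s, b s)) (p + q) t := by
  have hp' : HasDerivAt (fun s => Φ (a s, b t)) (fderiv ℝ Φ (a t, b t) (a', 0)) t :=
    hΦ.hasFDerivAt.comp_hasDerivAt (l := Φ) (f := fun s => (a s, b t)) t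
      (ha.prodMk (hasDerivAt_const t (b t)))
  have hq' : HasDerivAt (fun s => Φ (a t, b s)) (fderiv ℝ Φ (a t, b t) (0, b')) t :=
    hΦ.hasFDerivAt.comp_hasDerivAt (l := Φ) (f := fun s => (a t, b s)) t
      ((hasDerivAt_const t (a t)).prodMk hb)
  refine (hΦ.hasFDerivAt.comp_hasDerivAt t (ha.prodMk hb)).congr_deriv ?_
  rw [hp.unique hp', hq.unique hq', ← map_add, Prod.mk_add_mk, add_zero, zero_add]

variable [RiemannianBundle (fun x : M => TangentSpace 𝓘(ℝ, E) x)]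

lemma metricCoeff_comm (x₀ : M) (y a b : E) : metricCoeff x₀ y a b = metricCoeff x₀ y b a :=
  real_inner_comm _ _

lemma metricCoeff_add_left (x₀ : M) (y a a' b : E) :
    metricCoeff x₀ y (a + a') b = metricCoeff x₀ y a b + metricCoeff x₀ y a' b := by
  simp only [metricCoeff, map_add, inner_add_left]

lemma metricCoeff_smul_left (x₀ : M) (y : E) (c : ℝ) (a b : E) :
    metricCoeff x₀ y (c • a) b = c * metricCoeff x₀ y a b := by
  simp only [metricCoeff, map_smul, real_inner_smul_left]

lemma metricCoeff_add_right (x₀ : M) (y a b b' : E) :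
    metricCoeff x₀ y a (b + b') = metricCoeff x₀ y a b + metricCoeff x₀ y a b' := by
  simp only [metricCoeff, map_add, inner_add_right]

lemma metricCoeff_smul_right (x₀ : M) (y : E) (c : ℝ) (a b : E) :
    metricCoeff x₀ y a (c • b) = c * metricCoeff x₀ y a b := by
  simp only [metricCoeff, map_smul, real_inner_smul_right]

lemma fderiv_const_mul_metricCoeff (x₀ : M) (y a b : E) (c : ℝ) :
    fderiv ℝ (fun y => c * metricCoeff x₀ y a b) y
      = c • fderiv ℝ (fun y => metricCoeff x₀ y a b) y :=
  congrFun (fderiv_const_smul_field (f := fun y => metricCoeff x₀ y a b) c) y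

lemma hasDerivAt_metricCoeff_fixed_point (x₀ : M) (y : E) {v w : ℝ → E} {v' w' : E} {t : ℝ}
    (hv : HasDerivAt v v' t) (hw : HasDerivAt w w' t) :
    HasDerivAt (fun s => metricCoeff x₀ y (v s) (w s))
      (metricCoeff x₀ y v' (w t) + metricCoeff x₀ y (v t) w') t := by
  let A := (trivializationAt E (fun x : M => TangentSpace 𝓘(ℝ, E) x) x₀).symmL ℝ
    ((extChartAt 𝓘(ℝ, E) x₀).symm y)
  have h := (A.hasFDerivAt.comp_hasDerivAt t hv).inner ℝ (A.hasFDerivAt.comp_hasDerivAt t hw)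
  rw [add_comm] at h
  exact h

/-- Twice the inner product of `a` and the covariant derivative of a field with coordinates `v`,
with derivative `v'`, along a curve through `y` with velocity `u'`, as in `IsParallelAlong`. -/
def covariantPairing (x₀ : M) (y u' v v' a : E) : ℝ :=
  2 * metricCoeff x₀ y v' a
    + fderiv ℝ (fun y => metricCoeff x₀ y v a) y u'
    + fderiv ℝ (fun y => metricCoeff x₀ y u' a) y v
    - fderiv ℝ (fun y => metricCoeff x₀ y u' v) y a

lemma covariantPairing_smul (x₀ : M) (y : E) (c : ℝ) (u' v v' a : E) :
    covariantPairing x₀ y u' (c • v) (c • v') a = c * covariantPairing x₀ y u' v v' a := by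
  simp only [covariantPairing, metricCoeff_smul_left, metricCoeff_smul_right, map_smul,
    fderiv_const_mul_metricCoeff, smul_apply, smul_eq_mul]
  ring

lemma covariantPairing_smul_velocity (x₀ : M) (y : E) (c : ℝ) (u' v v' a : E) :
    covariantPairing x₀ y (c • u') v (c • v') a = c * covariantPairing x₀ y u' v v' a := by
  simp only [covariantPairing, metricCoeff_smul_left, map_smul, fderiv_const_mul_metricCoeff,
    smul_apply, smul_eq_mul]
  ring

variable [IsContMDiffRiemannianBundle 𝓘(ℝ, E) ∞ E (fun x : M => TangentSpace 𝓘(ℝ, E) x)]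

lemma differentiableAt_metricCoeff (x₀ : M) {N : Type*} [NormedAddCommGroup N] [NormedSpace ℝ N]
    {φ ψ χ : N → E} {n : N} (hφ : DifferentiableAt ℝ φ n) (hψ : DifferentiableAt ℝ ψ n)
    (hχ : DifferentiableAt ℝ χ n) (hn : φ n ∈ (extChartAt 𝓘(ℝ, E) x₀).target) :
    DifferentiableAt ℝ (fun q => metricCoeff x₀ (φ q) (ψ q) (χ q)) n := by
  have h := MDifferentiableAt.inner_bundle (IB := 𝓘(ℝ, E)) (F := E) (IM := 𝓘(ℝ, N))
    (E := fun x : M => TangentSpace 𝓘(ℝ, E) x)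
    (b := fun q : N => (extChartAt 𝓘(ℝ, E) x₀).symm (φ q))
    (v := fun q => (trivializationAt E (fun x : M => TangentSpace 𝓘(ℝ, E) x) x₀).symmL ℝ
      ((extChartAt 𝓘(ℝ, E) x₀).symm (φ q)) (ψ q))
    (w := fun q => (trivializationAt E (fun x : M => TangentSpace 𝓘(ℝ, E) x) x₀).symmL ℝ
      ((extChartAt 𝓘(ℝ, E) x₀).symm (φ q)) (χ q))
    (mdifferentiableAt_symmL x₀ hφ hψ hn) (mdifferentiableAt_symmL x₀ hφ hχ hn)
  exact h.differentiableAt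

lemma differentiableAt_metricCoeff_point (x₀ : M) {y : E}
    (hy : y ∈ (extChartAt 𝓘(ℝ, E) x₀).target) (a b : E) :
    DifferentiableAt ℝ (fun y => metricCoeff x₀ y a b) y :=
  differentiableAt_metricCoeff x₀ differentiableAt_fun_id (differentiableAt_const a)
    (differentiableAt_const b) hy

lemma hasDerivAt_metricCoeff (x₀ : M) {u v w : ℝ → E} {u' v' w' : E} {t : ℝ}
    (hy : u t ∈ (extChartAt 𝓘(ℝ, E) x₀).target)
    (hu : HasDerivAt u u' t) (hv : HasDerivAt v v' t) (hw : HasDerivAt w w' t) :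
    HasDerivAt (fun s => metricCoeff x₀ (u s) (v s) (w s))
      (fderiv ℝ (fun y => metricCoeff x₀ y (v t) (w t)) (u t) u'
        + (metricCoeff x₀ (u t) v' (w t) + metricCoeff x₀ (u t) (v t) w')) t := by
  have hΦ : DifferentiableAt ℝ (fun q : E × E × E => metricCoeff x₀ q.1 q.2.1 q.2.2)
      (u t, v t, w t) :=
    differentiableAt_metricCoeff x₀ (φ := fun q : E × E × E => q.1) (ψ := fun q => q.2.1)
      (χ := fun q => q.2.2) (by fun_prop) (by fun_prop) (by fun_prop) hy
  exact hasDerivAt_of_hasDerivAt_partial (b := fun s => (v s, w s)) hΦ hu (hv.prodMk hw)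
    ((differentiableAt_metricCoeff_point x₀ hy (v t) (w t)).hasFDerivAt.comp_hasDerivAt t hu)
    (hasDerivAt_metricCoeff_fixed_point x₀ (u t) hv hw)

lemma covariantPairing_add {x₀ : M} {y : E} (hy : y ∈ (extChartAt 𝓘(ℝ, E) x₀).target)
    (u' v v' w w' a : E) :
    covariantPairing x₀ y u' (v + w) (v' + w') a =
      covariantPairing x₀ y u' v v' a + covariantPairing x₀ y u' w w' a := by
  have hd := differentiableAt_metricCoeff_point x₀ hy
  simp only [covariantPairing, metricCoeff_add_left, metricCoeff_add_right, map_add]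
  rw [fderiv_fun_add (hd _ _) (hd _ _), fderiv_fun_add (hd _ _) (hd _ _)]
  simp only [add_apply]
  ring

end MetricCoefficients

section ParallelFields

variable {E : Type*} [NormedAddCommGroup E] [NormedSpace ℝ E]
  {M : Type*} [TopologicalSpace M] [ChartedSpace E M] {γ : ℝ → M}

/-- The coordinates of a curve at time `s`, in the chart centred at its point at time `t`. -/
def chartCurve (γ : ℝ → M) (t s : ℝ) : E := extChartAt 𝓘(ℝ, E) (γ t) (γ s)

lemma chartCurve_mem_target (γ : ℝ → M) (t : ℝ) :
    (chartCurve γ t t : E) ∈ (extChartAt 𝓘(ℝ, E) (γ t)).target :=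
  mem_extChartAt_target (γ t)

lemma differentiableAt_chartCurve (hγ : MDifferentiable 𝓘(ℝ, ℝ) 𝓘(ℝ, E) γ) (t : ℝ) :
    DifferentiableAt ℝ (chartCurve γ t : ℝ → E) t := by
  have h : MDifferentiableAt 𝓘(ℝ, E) 𝓘(ℝ, E) (extChartAt 𝓘(ℝ, E) (γ t)) (γ t) :=
    (contMDiffAt_extChartAt (n := ∞)).mdifferentiableAt (by simp)
  exact (h.comp t (hγ t)).differentiableAt

lemma hasDerivAt_affine (c d t : ℝ) : HasDerivAt (fun t : ℝ => c * t + d) c t := by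
  simpa using ((hasDerivAt_id t).const_mul c).add_const d

lemma velocity_comp_affine (hγ : MDifferentiable 𝓘(ℝ, ℝ) 𝓘(ℝ, E) γ) (c d t : ℝ) :
    velocity (E := E) (fun t => γ (c * t + d)) t = c • velocity (E := E) γ (c * t + d) := by
  have hchain := mfderiv_comp_apply (I := 𝓘(ℝ, ℝ)) (I' := 𝓘(ℝ, ℝ)) (I'' := 𝓘(ℝ, E))
    (g := γ) (f := fun t : ℝ => c * t + d) t (hγ (c * t + d))
    (hasDerivAt_affine c d t).differentiableAt.mdifferentiableAt (1 : ℝ)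
  have hderiv : mfderiv 𝓘(ℝ, ℝ) 𝓘(ℝ, ℝ) (fun t : ℝ => c * t + d) t (1 : ℝ) = c • (1 : ℝ) := by
    rw [mfderiv_eq_fderiv, (hasDerivAt_affine c d t).hasFDerivAt.fderiv]
    exact mul_comm (1 : ℝ) c
  rw [hderiv] at hchain
  exact hchain.trans ((mfderiv 𝓘(ℝ, ℝ) 𝓘(ℝ, E) γ (c * t + d)).map_smul c (1 : ℝ))

variable [IsManifold 𝓘(ℝ, E) ∞ M] {V W : ∀ t, TangentSpace 𝓘(ℝ, E) (γ t)}

/-- The coordinates at time `s` of a vector field along a curve, in the chart centred at the point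
of the curve at time `t`. -/
def chartField (γ : ℝ → M) (V : ∀ t, TangentSpace 𝓘(ℝ, E) (γ t)) (t s : ℝ) : E :=
  (trivializationAt E (fun x : M => TangentSpace 𝓘(ℝ, E) x) (γ t)
    (⟨γ s, V s⟩ : TangentBundle 𝓘(ℝ, E) M)).2

lemma differentiableAt_chartField
    (hV : MDifferentiable 𝓘(ℝ, ℝ) 𝓘(ℝ, E).tangent
      (fun t => (⟨γ t, V t⟩ : TangentBundle 𝓘(ℝ, E) M))) (t : ℝ) :
    DifferentiableAt ℝ (chartField γ V t) t :=
  ((mdifferentiableAt_totalSpace 𝓘(ℝ, E) _).1 (hV t)).2.differentiableAt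

lemma mdifferentiable_field_iff (hγ : MDifferentiable 𝓘(ℝ, ℝ) 𝓘(ℝ, E) γ) :
    MDifferentiable 𝓘(ℝ, ℝ) 𝓘(ℝ, E).tangent
      (fun t => (⟨γ t, V t⟩ : TangentBundle 𝓘(ℝ, E) M)) ↔
    ∀ t, DifferentiableAt ℝ (chartField γ V t) t :=
  ⟨differentiableAt_chartField, fun h t => (mdifferentiableAt_totalSpace 𝓘(ℝ, E) _).2
    ⟨hγ t, (h t).mdifferentiableAt⟩⟩

lemma eventually_mem_baseSet (hγ : MDifferentiable 𝓘(ℝ, ℝ) 𝓘(ℝ, E) γ) (t : ℝ) :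
    ∀ᶠ s in nhds t, γ s ∈
      (trivializationAt E (fun x : M => TangentSpace 𝓘(ℝ, E) x) (γ t)).baseSet :=
  (hγ t).continuousAt.preimage_mem_nhds
    ((trivializationAt E (fun x : M => TangentSpace 𝓘(ℝ, E) x) (γ t)).open_baseSet.mem_nhds
      (FiberBundle.mem_baseSet_trivializationAt' (γ t)))

lemma chartField_eq_continuousLinearMapAt {t s : ℝ}
    (hs : γ s ∈ (trivializationAt E (fun x : M => TangentSpace 𝓘(ℝ, E) x) (γ t)).baseSet) :
    chartField γ V t s =
      (trivializationAt E (fun x : M => TangentSpace 𝓘(ℝ, E) x) (γ t)).continuousLinearMapAt ℝ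
        (γ s) (V s) :=
  (Trivialization.continuousLinearMapAt_apply_of_mem (R := ℝ) _ hs _).symm

lemma chartField_zero (hγ : MDifferentiable 𝓘(ℝ, ℝ) 𝓘(ℝ, E) γ) (t : ℝ) :
    chartField γ 0 t =ᶠ[nhds t] fun _ => (0 : E) := by
  filter_upwards [eventually_mem_baseSet hγ t] with s hs
  rw [chartField_eq_continuousLinearMapAt hs, Pi.zero_apply, map_zero]

lemma chartField_add (hγ : MDifferentiable 𝓘(ℝ, ℝ) 𝓘(ℝ, E) γ) (t : ℝ) :
    chartField γ (V + W) t =ᶠ[nhds t] fun s => chartField γ V t s + chartField γ W t s := by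
  filter_upwards [eventually_mem_baseSet hγ t] with s hs
  simp only [chartField_eq_continuousLinearMapAt hs, Pi.add_apply, map_add]

lemma chartField_smul (hγ : MDifferentiable 𝓘(ℝ, ℝ) 𝓘(ℝ, E) γ) (c t : ℝ) :
    chartField γ (c • V) t =ᶠ[nhds t] fun s => c • chartField γ V t s := by
  filter_upwards [eventually_mem_baseSet hγ t] with s hs
  simp only [chartField_eq_continuousLinearMapAt hs, Pi.smul_apply, map_smul]

variable [RiemannianBundle (fun x : M => TangentSpace 𝓘(ℝ, E) x)]

lemma inner_eq_metricCoeff (hγ : MDifferentiable 𝓘(ℝ, ℝ) 𝓘(ℝ, E) γ) (t : ℝ) :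
    (fun s => inner ℝ (V s) (W s)) =ᶠ[nhds t] fun s =>
      metricCoeff (γ t) (chartCurve γ t s) (chartField γ V t s) (chartField γ W t s) := by
  filter_upwards [eventually_mem_baseSet hγ t] with s hs
  have hpoint : (extChartAt 𝓘(ℝ, E) (γ t)).symm (chartCurve γ t s) = γ s :=
    (extChartAt 𝓘(ℝ, E) (γ t)).left_inv (by rwa [extChartAt_source])
  rw [metricCoeff, hpoint, chartField_eq_continuousLinearMapAt hs,
    chartField_eq_continuousLinearMapAt hs, Trivialization.symmL_continuousLinearMapAt _ hs,
    Trivialization.symmL_continuousLinearMapAt _ hs]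

lemma isParallelAlong_iff :
    IsParallelAlong γ V ↔
      MDifferentiable 𝓘(ℝ, ℝ) 𝓘(ℝ, E).tangent
        (fun t => (⟨γ t, V t⟩ : TangentBundle 𝓘(ℝ, E) M)) ∧
      ∀ (t : ℝ) (a : E), covariantPairing (γ t) (chartCurve γ t t) (deriv (chartCurve γ t) t)
        (chartField γ V t t) (deriv (chartField γ V t) t) a = 0 := Iff.rfl

lemma IsParallelAlong.mdifferentiable (hV : IsParallelAlong γ V) :
    MDifferentiable 𝓘(ℝ, ℝ) 𝓘(ℝ, E) γ :=
  fun t => ((mdifferentiableAt_totalSpace 𝓘(ℝ, E) _).1 (hV.1 t)).1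

lemma IsParallelAlong.hasDerivAt_chartField (hV : IsParallelAlong γ V) (t : ℝ) :
    HasDerivAt (chartField γ V t) (deriv (chartField γ V t) t) t :=
  (differentiableAt_chartField hV.1 t).hasDerivAt

lemma isParallelAlong_of_hasDerivAt (hγ : MDifferentiable 𝓘(ℝ, ℝ) 𝓘(ℝ, E) γ) {v : ℝ → ℝ → E}
    {v' : ℝ → E} (heq : ∀ t, chartField γ V t =ᶠ[nhds t] v t) (hv : ∀ t, HasDerivAt (v t) (v' t) t)
    (h : ∀ (t : ℝ) (a : E), covariantPairing (γ t) (chartCurve γ t t)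
      (deriv (chartCurve γ t) t) (v t t) (v' t) a = 0) :
    IsParallelAlong γ V := by
  refine isParallelAlong_iff.2 ⟨(mdifferentiable_field_iff hγ).2 fun t =>
    (hv t).differentiableAt.congr_of_eventuallyEq (heq t), fun t a => ?_⟩
  rw [(heq t).deriv_eq, (heq t).eq_of_nhds, (hv t).deriv, h]

lemma isParallelAlong_zero (hγ : MDifferentiable 𝓘(ℝ, ℝ) 𝓘(ℝ, E) γ) :
    IsParallelAlong γ (0 : ∀ t, TangentSpace 𝓘(ℝ, E) (γ t)) :=
  isParallelAlong_of_hasDerivAt hγ (v' := 0) (chartField_zero hγ) (fun t => hasDerivAt_const t 0)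
    fun t a => by
      simpa only [zero_smul, zero_mul, Pi.zero_apply] using covariantPairing_smul (γ t)
        (chartCurve γ t t) 0 (deriv (chartCurve γ t) t) 0 0 a

lemma IsParallelAlong.smul (c : ℝ) (hV : IsParallelAlong γ V) : IsParallelAlong γ (c • V) :=
  isParallelAlong_of_hasDerivAt hV.mdifferentiable (chartField_smul hV.mdifferentiable c)
    (fun t => (hV.hasDerivAt_chartField t).const_smul c) fun t a => by
      rw [covariantPairing_smul, (isParallelAlong_iff.1 hV).2 t a, mul_zero]

lemma IsParallelAlong.comp_affine (hV : IsParallelAlong γ V) (c d : ℝ) :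
    IsParallelAlong (fun t => γ (c * t + d)) (fun t => V (c * t + d)) := by
  refine isParallelAlong_iff.2 ⟨fun t => ?_, fun t a => ?_⟩
  · exact (hV.1 (c * t + d)).comp t (hasDerivAt_affine c d t).differentiableAt.mdifferentiableAt
  · have hcurve : HasDerivAt (chartCurve (E := E) (fun t => γ (c * t + d)) t)
        (c • deriv (chartCurve γ (c * t + d)) (c * t + d)) t :=
      HasDerivAt.scomp (g₁ := chartCurve γ (c * t + d)) t
        (differentiableAt_chartCurve hV.mdifferentiable (c * t + d)).hasDerivAt
        (hasDerivAt_affine c d t)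
    have hfield : HasDerivAt (chartField (fun t => γ (c * t + d)) (fun t => V (c * t + d)) t)
        (c • deriv (chartField γ V (c * t + d)) (c * t + d)) t :=
      HasDerivAt.scomp (g₁ := chartField γ V (c * t + d)) t
        (hV.hasDerivAt_chartField (c * t + d)) (hasDerivAt_affine c d t)
    rw [hcurve.deriv, hfield.deriv, covariantPairing_smul_velocity]
    exact mul_eq_zero_of_right c ((isParallelAlong_iff.1 hV).2 (c * t + d) a)

lemma IsParallelAlong.congr {γ' : ℝ → M} {V' : ∀ t, TangentSpace 𝓘(ℝ, E) (γ' t)}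
    (hV : IsParallelAlong γ V)
    (h : ∀ t, (⟨γ' t, V' t⟩ : TangentBundle 𝓘(ℝ, E) M) = ⟨γ t, V t⟩) : IsParallelAlong γ' V' := by
  obtain rfl : γ' = γ := funext fun t => congrArg TotalSpace.proj (h t)
  obtain rfl : V' = V := funext fun t => TotalSpace.mk_injective (γ' t) (h t)
  exact hV

lemma IsParallelAlong.exists_of_comp_affine {c d : ℝ} (hc : c ≠ 0)
    {U : ∀ r, TangentSpace 𝓘(ℝ, E) (γ (c * r + d))}
    (hU : IsParallelAlong (fun r => γ (c * r + d)) U) :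
    ∃ V : ∀ t, TangentSpace 𝓘(ℝ, E) (γ t), IsParallelAlong γ V ∧ ∀ r, V (c * r + d) = U r := by
  have hinv (t : ℝ) : c * (c⁻¹ * t + -(c⁻¹ * d)) + d = t := by field_simp; ring
  let V (t : ℝ) : TangentSpace 𝓘(ℝ, E) (γ t) := hinv t ▸ U (c⁻¹ * t + -(c⁻¹ * d))
  have hVU (t : ℝ) : (⟨γ t, V t⟩ : TangentBundle 𝓘(ℝ, E) M) =
      ⟨γ (c * (c⁻¹ * t + -(c⁻¹ * d)) + d), U (c⁻¹ * t + -(c⁻¹ * d))⟩ := by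
    have cast_eq : ∀ (q : ℝ) (hq : q = t) (w : TangentSpace 𝓘(ℝ, E) (γ q)),
        (⟨γ t, hq ▸ w⟩ : TangentBundle 𝓘(ℝ, E) M) = ⟨γ q, w⟩ := by
      rintro q rfl w
      rfl
    exact cast_eq _ (hinv t) _
  refine ⟨V, (hU.comp_affine c⁻¹ (-(c⁻¹ * d))).congr hVU, fun r => ?_⟩
  have hr : c⁻¹ * (c * r + d) + -(c⁻¹ * d) = r := by field_simp; ring
  refine TotalSpace.mk_injective _ ((hVU (c * r + d)).trans ?_)
  exact congrArg (fun q => (⟨γ (c * q + d), U q⟩ : TangentBundle 𝓘(ℝ, E) M)) hr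

lemma IsGeodesic.mdifferentiable (hγ : IsGeodesic (E := E) γ) :
    MDifferentiable 𝓘(ℝ, ℝ) 𝓘(ℝ, E) γ :=
  IsParallelAlong.mdifferentiable hγ

lemma IsGeodesic.comp_affine (hγ : IsGeodesic (E := E) γ) (c d : ℝ) :
    IsGeodesic (E := E) (fun t => γ (c * t + d)) :=
  ((IsParallelAlong.comp_affine hγ c d).smul c).congr fun t =>
    congrArg (TotalSpace.mk _) (velocity_comp_affine hγ.mdifferentiable c d t)

lemma GeodesicallyComplete.isGeodesicFrom (hM : GeodesicallyComplete E M)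
    (v : TangentBundle 𝓘(ℝ, E) M) : IsGeodesicFrom v (geodesic v) := by
  rw [geodesic, dif_pos (hM v)]
  exact (hM v).choose_spec

variable [IsContMDiffRiemannianBundle 𝓘(ℝ, E) ∞ E (fun x : M => TangentSpace 𝓘(ℝ, E) x)]

lemma IsParallelAlong.add (hV : IsParallelAlong γ V) (hW : IsParallelAlong γ W) :
    IsParallelAlong γ (V + W) :=
  isParallelAlong_of_hasDerivAt hV.mdifferentiable (chartField_add hV.mdifferentiable)
    (fun t => (hV.hasDerivAt_chartField t).add (hW.hasDerivAt_chartField t)) fun t a => by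
      rw [covariantPairing_add (chartCurve_mem_target γ t), (isParallelAlong_iff.1 hV).2 t a,
        (isParallelAlong_iff.1 hW).2 t a, add_zero]

/-- The space of parallel fields along a curve. -/
def parallelFields (hγ : MDifferentiable 𝓘(ℝ, ℝ) 𝓘(ℝ, E) γ) :
    Submodule ℝ (∀ t, TangentSpace 𝓘(ℝ, E) (γ t)) where
  carrier := {V | IsParallelAlong γ V}
  zero_mem' := isParallelAlong_zero hγ
  add_mem' := IsParallelAlong.add
  smul_mem' c _ := IsParallelAlong.smul c

-- The derivatives of the metric in the three directions cancel because the Christoffel symbols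
-- of `IsParallelAlong` are symmetrized: the connection is compatible with the metric.
lemma IsParallelAlong.hasDerivAt_inner (hV : IsParallelAlong γ V) (hW : IsParallelAlong γ W)
    (t : ℝ) : HasDerivAt (fun s => inner ℝ (V s) (W s)) 0 t := by
  have hγ := hV.mdifferentiable
  have hderiv := (hasDerivAt_metricCoeff (γ t) (chartCurve_mem_target γ t)
    (differentiableAt_chartCurve hγ t).hasDerivAt (hV.hasDerivAt_chartField t)
    (hW.hasDerivAt_chartField t)).congr_of_eventuallyEq (inner_eq_metricCoeff hγ t)
  refine hderiv.congr_deriv ?_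
  have hVW := (isParallelAlong_iff.1 hV).2 t (chartField γ W t t)
  have hWV := (isParallelAlong_iff.1 hW).2 t (chartField γ V t t)
  simp only [covariantPairing] at hVW hWV
  simp only [metricCoeff_comm (γ t) _ (chartField γ W t t) (chartField γ V t t)] at hWV
  rw [metricCoeff_comm (γ t) _ (deriv (chartField γ W t) t)] at hWV
  linarith

lemma IsParallelAlong.inner_eq (hV : IsParallelAlong γ V) (hW : IsParallelAlong γ W)
    (s t : ℝ) : inner ℝ (V s) (W s) = inner ℝ (V t) (W t) :=
  is_const_of_deriv_eq_zero (fun t => (hV.hasDerivAt_inner hW t).differentiableAt)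
    (fun t => (hV.hasDerivAt_inner hW t).deriv) s t

lemma IsParallelAlong.norm_eq (hV : IsParallelAlong γ V) (s t : ℝ) : ‖V s‖ = ‖V t‖ := by
  rw [norm_eq_sqrt_real_inner, norm_eq_sqrt_real_inner, hV.inner_eq hV s t]

end ParallelFields

section Gradient

variable {E : Type*} [NormedAddCommGroup E] [NormedSpace ℝ E] [FiniteDimensional ℝ E]
  {M : Type*} [TopologicalSpace M] [ChartedSpace E M]

instance finiteDimensional_tangentSpace (x : M) : FiniteDimensional ℝ (TangentSpace 𝓘(ℝ, E) x) :=
  inferInstanceAs (FiniteDimensional ℝ E)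

variable [RiemannianBundle (fun x : M => TangentSpace 𝓘(ℝ, E) x)] {φ : M → ℝ} {γ : ℝ → M}

instance completeSpace_tangentSpace (x : M) : CompleteSpace (TangentSpace 𝓘(ℝ, E) x) :=
  FiniteDimensional.complete ℝ _

lemma inner_grad (φ : M → ℝ) (x : M) (w : TangentSpace 𝓘(ℝ, E) x) :
    inner ℝ (grad φ x) w = mvfderiv 𝓘(ℝ, E) φ x w :=
  InnerProductSpace.toDual_symm_apply

lemma hasDerivAt_comp_curve (hφ : MDifferentiable 𝓘(ℝ, E) 𝓘(ℝ, ℝ) φ)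
    (hγ : MDifferentiable 𝓘(ℝ, ℝ) 𝓘(ℝ, E) γ) (t : ℝ) :
    HasDerivAt (fun s => φ (γ s)) (inner ℝ (grad φ (γ t)) (velocity (E := E) γ t)) t := by
  rw [inner_grad]
  have h : HasFDerivAt (fun s => φ (γ s)) (show ℝ →L[ℝ] ℝ from
      (mfderiv 𝓘(ℝ, E) 𝓘(ℝ, ℝ) φ (γ t)).comp (mfderiv 𝓘(ℝ, ℝ) 𝓘(ℝ, E) γ t)) t :=
    ((hφ (γ t)).hasMFDerivAt.comp t (hγ t).hasMFDerivAt).hasFDerivAt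
  exact h.hasDerivAt

end Gradient

section QuadraticUpperBound

variable {E : Type*} [NormedAddCommGroup E] [NormedSpace ℝ E] [FiniteDimensional ℝ E]
  {M : Type*} [TopologicalSpace M] [ChartedSpace E M] [IsManifold 𝓘(ℝ, E) ∞ M]
  [RiemannianBundle (fun x : M => TangentSpace 𝓘(ℝ, E) x)]

variable (E) in
/-- The descent inequality with constant `L`, the consequence of `L`-smoothness which is inherited
by expectations. -/
def HasQuadraticUpperBound (L : ℝ) (f : M → ℝ) : Prop :=
  ∀ v : TangentBundle 𝓘(ℝ, E) M,
    f (expMap v) ≤ f v.proj + inner ℝ (grad f v.proj) v.snd + L / 2 * ‖v.snd‖ ^ 2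

variable {Ξ : Type*} [MeasurableSpace Ξ]

variable (E) in
/-- `∇F(x, ξ)`, with `ξ` distributed as `D`, is an unbiased estimator of `∇f(x)` for all `x`.
Integrability is required since a non-integrable function has integral `0` in Mathlib. -/
structure IsUnbiasedGrad (D : Measure Ξ) (F : M → Ξ → ℝ) (f : M → ℝ) : Prop where
  integrable : ∀ x, Integrable (fun ξ => grad (E := E) (fun y => F y ξ) x) D
  integral_eq : ∀ x, ∫ ξ, grad (E := E) (fun y => F y ξ) x ∂D = grad f x

variable {D : Measure Ξ} [IsProbabilityMeasure D] {F : M → Ξ → ℝ} {f : M → ℝ} {L : ℝ}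

lemma HasQuadraticUpperBound.integral (h : ∀ ξ, HasQuadraticUpperBound E L fun x => F x ξ)
    (hF : ∀ x, Integrable (F x) D) (hf : ∀ x, f x = ∫ ξ, F x ξ ∂D)
    (hgrad : IsUnbiasedGrad E D F f) : HasQuadraticUpperBound E L f := by
  intro v
  have hint : Integrable (fun ξ => inner ℝ (grad (E := E) (fun y => F y ξ) v.proj) v.snd) D :=
    (hgrad.integrable v.proj).inner_const v.snd
  have hinner : ∫ ξ, inner ℝ (grad (E := E) (fun y => F y ξ) v.proj) v.snd ∂D
      = inner ℝ (grad f v.proj) v.snd := by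
    rw [← hgrad.integral_eq]
    simp_rw [real_inner_comm v.snd]
    exact integral_inner (hgrad.integrable v.proj) v.snd
  calc f (expMap v) = ∫ ξ, F (expMap v) ξ ∂D := hf _
    _ ≤ ∫ ξ, ((F v.proj ξ + inner ℝ (grad (E := E) (fun y => F y ξ) v.proj) v.snd)
          + L / 2 * ‖v.snd‖ ^ 2) ∂D :=
        integral_mono (hF _) (((hF _).add hint).add (integrable_const _)) fun ξ => h ξ v
    _ = ∫ ξ, (F v.proj ξ + inner ℝ (grad (E := E) (fun y => F y ξ) v.proj) v.snd) ∂D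
          + L / 2 * ‖v.snd‖ ^ 2 := by
        rw [integral_add (f := fun ξ => F v.proj ξ + _) ((hF v.proj).add hint)
          (integrable_const _), integral_const, probReal_univ, one_smul]
    _ = f v.proj + inner ℝ (grad f v.proj) v.snd + L / 2 * ‖v.snd‖ ^ 2 := by
        rw [integral_add (hF _) hint, hinner, ← hf]

end QuadraticUpperBound

section DescentInequality

variable {E : Type*} [NormedAddCommGroup E] [NormedSpace ℝ E] [FiniteDimensional ℝ E]
  {M : Type*} [TopologicalSpace M] [ChartedSpace E M] [IsManifold 𝓘(ℝ, E) ∞ M]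
  [RiemannianBundle (fun x : M => TangentSpace 𝓘(ℝ, E) x)]
  {γ : ℝ → M} {φ : M → ℝ} {L : ℝ}

-- The definition compares times `0` and `1`; apply it to `r ↦ γ ((t - s) r + s)`.
lemma IsGeodesicallySmooth.exists_isParallelAlong (hφ : IsGeodesicallySmooth E L φ)
    (hγ : IsGeodesic (E := E) γ) {s t : ℝ} (hst : s ≠ t) :
    ∃ V : ∀ r, TangentSpace 𝓘(ℝ, E) (γ r), IsParallelAlong γ V ∧ V t = grad φ (γ t) ∧
      ‖grad φ (γ s) - V s‖ ≤ L * ‖(t - s) • velocity (E := E) γ s‖ := by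
  obtain ⟨_, ⟨U, hU, hU₁, rfl⟩, hbound⟩ := hφ.2 _ (hγ.comp_affine (t - s) s)
  obtain ⟨V, hV, hVU⟩ := hU.exists_of_comp_affine (sub_ne_zero.2 hst.symm)
  have hs : (t - s) * 0 + s = s := by ring
  have ht : (t - s) * 1 + s = t := by ring
  refine ⟨V, hV, ?_, ?_⟩
  · have hV₁ : V ((t - s) * 1 + s) = grad φ (γ ((t - s) * 1 + s)) := (hVU 1).trans hU₁
    rwa [ht] at hV₁
  · rw [velocity_comp_affine hγ.mdifferentiable, ← hVU 0] at hbound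
    rwa [hs] at hbound

variable [IsContMDiffRiemannianBundle 𝓘(ℝ, E) ∞ E (fun x : M => TangentSpace 𝓘(ℝ, E) x)]

lemma IsGeodesicallySmooth.inner_grad_velocity_le (hφ : IsGeodesicallySmooth E L φ)
    (hγ : IsGeodesic (E := E) γ) {t : ℝ} (ht : 0 < t) :
    inner ℝ (grad φ (γ t)) (velocity (E := E) γ t) ≤
      inner ℝ (grad φ (γ 0)) (velocity (E := E) γ 0)
        + L * t * ‖velocity (E := E) γ 0‖ ^ 2 := by
  obtain ⟨V, hV, hVt, hbound⟩ := hφ.exists_isParallelAlong hγ ht.ne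
  rw [sub_zero, norm_smul, Real.norm_of_nonneg ht.le, norm_sub_rev] at hbound
  rw [← hVt, hV.inner_eq hγ t 0, ← sub_le_iff_le_add', ← inner_sub_left]
  calc inner ℝ (V 0 - grad φ (γ 0)) (velocity (E := E) γ 0)
      ≤ ‖V 0 - grad φ (γ 0)‖ * ‖velocity (E := E) γ 0‖ := real_inner_le_norm _ _
    _ ≤ L * (t * ‖velocity (E := E) γ 0‖) * ‖velocity (E := E) γ 0‖ := by gcongr
    _ = L * t * ‖velocity (E := E) γ 0‖ ^ 2 := by ring

lemma IsGeodesicallySmooth.le_along_geodesic (hφ : IsGeodesicallySmooth E L φ)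
    (hγ : IsGeodesic (E := E) γ) :
    φ (γ 1) ≤ φ (γ 0) + inner ℝ (grad φ (γ 0)) (velocity (E := E) γ 0)
      + L / 2 * ‖velocity (E := E) γ 0‖ ^ 2 := by
  set A := inner ℝ (grad φ (γ 0)) (velocity (E := E) γ 0)
  set N := ‖velocity (E := E) γ 0‖ ^ 2
  have hderiv (t : ℝ) : HasDerivAt (fun s => φ (γ s) - (s * A + L / 2 * s ^ 2 * N))
      (inner ℝ (grad φ (γ t)) (velocity (E := E) γ t) - (A + L * t * N)) t := by
    refine (hasDerivAt_comp_curve hφ.1 hγ.mdifferentiable t).sub ?_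
    refine (((hasDerivAt_id t).mul_const A).add
      ((((hasDerivAt_id t).pow 2).const_mul (L / 2)).mul_const N)).congr_deriv ?_
    simp only [id_eq, Nat.cast_ofNat, Nat.add_one_sub_one, pow_one]
    ring
  have hanti : AntitoneOn (fun s => φ (γ s) - (s * A + L / 2 * s ^ 2 * N)) (Set.Icc 0 1) := by
    refine antitoneOn_of_deriv_nonpos (convex_Icc 0 1)
      (fun t _ => (hderiv t).continuousAt.continuousWithinAt)
      (fun t _ => (hderiv t).differentiableAt.differentiableWithinAt) fun t ht => ?_
    rw [interior_Icc] at ht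
    rw [(hderiv t).deriv]
    exact sub_nonpos.2 (hφ.inner_grad_velocity_le hγ ht.1)
  have h₁₀ := hanti (Set.left_mem_Icc.2 zero_le_one) (Set.right_mem_Icc.2 zero_le_one) zero_le_one
  simp only at h₁₀
  linarith

lemma IsGeodesicallySmooth.hasQuadraticUpperBound (hM : GeodesicallyComplete E M)
    (hφ : IsGeodesicallySmooth E L φ) : HasQuadraticUpperBound E L φ := by
  have along_geodesic : ∀ (v : TangentBundle 𝓘(ℝ, E) M) (γ : ℝ → M), IsGeodesicFrom v γ →
      φ (γ 1) ≤ φ v.proj + inner ℝ (grad φ v.proj) v.snd + L / 2 * ‖v.snd‖ ^ 2 := by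
    rintro _ γ ⟨hγ, rfl⟩
    exact hφ.le_along_geodesic hγ
  exact fun v => along_geodesic v _ (hM.isGeodesicFrom v)

end DescentInequality

section ParallelTransport

lemma exists_contraction_comp_eq {P H G : Type*} [AddCommGroup P] [Module ℝ P]
    [NormedAddCommGroup H] [InnerProductSpace ℝ H] [NormedAddCommGroup G] [NormedSpace ℝ G]
    (a : P →ₗ[ℝ] H) (b : P →ₗ[ℝ] G) [a.range.HasOrthogonalProjection]
    (hab : ∀ V, ‖b V‖ ≤ ‖a V‖) :
    ∃ T : H →L[ℝ] G, (∀ w, ‖T w‖ ≤ ‖w‖) ∧ ∀ V, T (a V) = b V := by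
  obtain ⟨lift, hlift⟩ := a.rangeRestrict.exists_rightInverse_of_surjective a.range_rangeRestrict
  have ha (w : a.range) : a (lift w) = w := congrArg Subtype.val (LinearMap.congr_fun hlift w)
  have hb {V V' : P} (h : a V = a V') : b V = b V' := by
    have := hab (V - V')
    rwa [map_sub, map_sub, h, sub_self, norm_zero, norm_le_zero_iff, sub_eq_zero] at this
  have hbound (w : a.range) : ‖(b ∘ₗ lift) w‖ ≤ 1 * ‖w‖ := by
    have := hab (lift w)
    rwa [ha, ← one_mul ‖(w : H)‖] at this
  refine ⟨((b ∘ₗ lift).mkContinuous 1 hbound).comp a.range.orthogonalProjectionOnto,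
    fun w => ?_, fun V => ?_⟩
  · exact (hbound _).trans (by
      rw [one_mul]; exact a.range.norm_orthogonalProjectionOnto_apply_le w)
  · have hproj : a.range.orthogonalProjectionOnto (a V) = ⟨a V, V, rfl⟩ :=
      Submodule.orthogonalProjectionOnto_mem_subspace_eq_self (K := a.range) ⟨a V, V, rfl⟩
    change b (lift (a.range.orthogonalProjectionOnto (a V))) = b V
    exact hb ((ha _).trans (congrArg Subtype.val hproj))

variable {E : Type*} [NormedAddCommGroup E] [NormedSpace ℝ E]
  {M : Type*} [TopologicalSpace M] [ChartedSpace E M] [IsManifold 𝓘(ℝ, E) ∞ M]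
  [RiemannianBundle (fun x : M => TangentSpace 𝓘(ℝ, E) x)]
  {γ : ℝ → M} {φ : M → ℝ} {L : ℝ}

open Classical in
/-- The construction of `transport` for an arbitrary curve: the value at time `1` of a chosen
parallel field along `γ` with initial value `w`, a tangent vector at `x = γ 0`. -/
def transportAlong (γ : ℝ → M) (x : M) (w : TangentSpace 𝓘(ℝ, E) x) :
    TangentSpace 𝓘(ℝ, E) (γ 1) :=
  if h : ∃ V : ∀ t, TangentSpace 𝓘(ℝ, E) (γ t), IsParallelAlong γ V ∧
      (⟨γ 0, V 0⟩ : TangentBundle 𝓘(ℝ, E) M) = ⟨x, w⟩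
  then h.choose 1 else 0

variable [FiniteDimensional ℝ E]
  [IsContMDiffRiemannianBundle 𝓘(ℝ, E) ∞ E (fun x : M => TangentSpace 𝓘(ℝ, E) x)]

lemma exists_transportAlong_clm (hγ : MDifferentiable 𝓘(ℝ, ℝ) 𝓘(ℝ, E) γ) :
    ∃ T : TangentSpace 𝓘(ℝ, E) (γ 0) →L[ℝ] TangentSpace 𝓘(ℝ, E) (γ 1),
      (∀ w, ‖T w‖ ≤ ‖w‖) ∧
      ∀ V, IsParallelAlong γ V → T (V 0) = V 1 ∧ transportAlong γ (γ 0) (V 0) = V 1 := by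
  obtain ⟨T, hT, hTV⟩ := exists_contraction_comp_eq
    (LinearMap.proj 0 ∘ₗ (parallelFields hγ).subtype)
    (LinearMap.proj 1 ∘ₗ (parallelFields hγ).subtype) fun V => (V.2.norm_eq 1 0).le
  have hT₁ {V} (hV : IsParallelAlong γ V) : T (V 0) = V 1 := hTV ⟨V, hV⟩
  refine ⟨T, hT, fun V hV => ⟨hT₁ hV, ?_⟩⟩
  have hex : ∃ U : ∀ t, TangentSpace 𝓘(ℝ, E) (γ t), IsParallelAlong γ U ∧
      (⟨γ 0, U 0⟩ : TangentBundle 𝓘(ℝ, E) M) = ⟨γ 0, V 0⟩ := ⟨V, hV, rfl⟩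
  obtain ⟨hU, hUV⟩ := hex.choose_spec
  rw [transportAlong, dif_pos hex, ← hT₁ hU, TotalSpace.mk_injective _ hUV, hT₁ hV]

-- Parallel fields with given initial value need not exist here, so `transportAlong` is only known
-- to be linear on the subspace `S` of the vectors which do extend.
lemma IsGeodesicFrom.exists_transportAlong_clm {v : TangentBundle 𝓘(ℝ, E) M}
    (h : IsGeodesicFrom v γ) :
    ∃ (S : Submodule ℝ (TangentSpace 𝓘(ℝ, E) v.proj))
      (T : TangentSpace 𝓘(ℝ, E) v.proj →L[ℝ] TangentSpace 𝓘(ℝ, E) (γ 1)),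
      (∀ w, ‖T w‖ ≤ ‖w‖) ∧ (∀ w ∈ S, transportAlong γ v.proj w = T w) ∧ v.snd ∈ S ∧
      ∀ (L : ℝ) (φ : M → ℝ), IsGeodesicallySmooth E L φ →
        grad φ v.proj ∈ S ∧ ‖grad φ (γ 1) - T (grad φ v.proj)‖ ≤ L * ‖v.snd‖ := by
  obtain ⟨hγ, rfl⟩ := h
  obtain ⟨T, hT, hTV⟩ := RPAGE.exists_transportAlong_clm hγ.mdifferentiable
  refine ⟨(parallelFields hγ.mdifferentiable).map (LinearMap.proj 0), T, hT, ?_,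
    ⟨_, hγ, rfl⟩, fun L φ hφ => ?_⟩
  · rintro _ ⟨V, hV, rfl⟩
    exact (hTV V hV).2.trans (hTV V hV).1.symm
  · obtain ⟨V, hV, hV₀, hbound⟩ := hφ.exists_isParallelAlong hγ one_ne_zero
    rw [zero_sub, neg_one_smul, norm_neg, IsParallelAlong.norm_eq hγ 1 0, ← (hTV V hV).1,
      hV₀] at hbound
    exact ⟨⟨V, hV, hV₀⟩, hbound⟩

lemma GeodesicallyComplete.exists_transport_clm (hM : GeodesicallyComplete E M)
    (v : TangentBundle 𝓘(ℝ, E) M) :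
    ∃ (S : Submodule ℝ (TangentSpace 𝓘(ℝ, E) v.proj))
      (T : TangentSpace 𝓘(ℝ, E) v.proj →L[ℝ] TangentSpace 𝓘(ℝ, E) (expMap v)),
      (∀ w, ‖T w‖ ≤ ‖w‖) ∧ (∀ w ∈ S, transport v w = T w) ∧ v.snd ∈ S ∧
      ∀ (L : ℝ) (φ : M → ℝ), IsGeodesicallySmooth E L φ →
        grad φ v.proj ∈ S ∧ ‖grad φ (expMap v) - T (grad φ v.proj)‖ ≤ L * ‖v.snd‖ :=
  (hM.isGeodesicFrom v).exists_transportAlong_clm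

end ParallelTransport

section SampleMeans

lemma lintegral_pi_succ_le {Ξ : Type*} [MeasurableSpace Ξ] (μ : Measure Ξ) [SigmaFinite μ] {n : ℕ}
    (h : (Fin (n + 1) → Ξ) → ENNReal) :
    ∫⁻ ξ, h ξ ∂(Measure.pi fun _ => μ) ≤
      ∫⁻ a, ∫⁻ ξ, h (Fin.cons a ξ) ∂(Measure.pi fun _ => μ) ∂μ := by
  have hcons := (measurePreserving_piFinSuccAbove (fun _ : Fin (n + 1) => μ) 0).symm
  rw [hcons.lintegral_map_equiv h]
  refine (lintegral_prod_le _).trans (le_of_eq ?_)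
  simp only [MeasurableEquiv.piFinSuccAbove_symm_apply, Fin.insertNthEquiv_zero]
  rfl

lemma inv_smul_sum_sub {H : Type*} [AddCommGroup H] [Module ℝ H] {m : ℕ} (hm : 0 < m)
    (a : Fin m → H) (c : H) :
    (m : ℝ)⁻¹ • ∑ i, (a i - c) = (m : ℝ)⁻¹ • ∑ i, a i - c := by
  have hm' : (m : ℝ) ≠ 0 := Nat.cast_ne_zero.2 hm.ne'
  rw [Finset.sum_sub_distrib, smul_sub, Finset.sum_const, Finset.card_univ, Fintype.card_fin,
    ← Nat.cast_smul_eq_nsmul ℝ, smul_smul, inv_mul_cancel₀ hm', one_smul]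

lemma enorm_sq_eq_ofReal {H : Type*} [SeminormedAddGroup H] (x : H) :
    ‖x‖ₑ ^ 2 = ENNReal.ofReal (‖x‖ ^ 2) := by
  rw [ENNReal.ofReal_pow (norm_nonneg x), ofReal_norm]

variable {Ξ : Type*} [MeasurableSpace Ξ] {μ : Measure Ξ}

lemma lintegral_enorm_sq_lt_top_iff {H : Type*} [NormedAddCommGroup H] {Y : Ξ → H}
    (hY : AEStronglyMeasurable Y μ) : ∫⁻ ξ, ‖Y ξ‖ₑ ^ 2 ∂μ < ⊤ ↔ MemLp Y 2 μ := by
  rw [memLp_two_iff_integrable_sq_norm hY, Integrable, hasFiniteIntegral_iff_enorm,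
    and_iff_right (show AEStronglyMeasurable (fun ξ => ‖Y ξ‖ ^ 2) μ from hY.norm.pow 2)]
  simp only [enorm_pow, enorm_norm]

variable [IsProbabilityMeasure μ]

lemma sq_lintegral_le_lintegral_sq (h : Ξ → ENNReal) :
    (∫⁻ ξ, h ξ ∂μ) ^ 2 ≤ ∫⁻ ξ, h ξ ^ 2 ∂μ := by
  obtain ⟨k, hk, hkh, hk_eq⟩ := exists_measurable_le_lintegral_eq μ h
  have hcauchy := ENNReal.lintegral_mul_le_Lp_mul_Lq μ Real.HolderConjugate.two_two
    hk.aemeasurable (aemeasurable_const (b := (1 : ENNReal)))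
  simp only [Pi.mul_apply, mul_one, one_pow, ENNReal.one_rpow, lintegral_const,
    measure_univ, ENNReal.rpow_two] at hcauchy
  calc (∫⁻ ξ, h ξ ∂μ) ^ 2 ≤ ((∫⁻ ξ, k ξ ^ 2 ∂μ) ^ (1 / 2 : ℝ)) ^ 2 := by
        rw [hk_eq]
        gcongr
    _ = ∫⁻ ξ, k ξ ^ 2 ∂μ := by
        rw [← ENNReal.rpow_natCast, ← ENNReal.rpow_mul]
        norm_num
    _ ≤ ∫⁻ ξ, h ξ ^ 2 ∂μ := by
        gcongr
        exact hkh _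

variable {H : Type*} [NormedAddCommGroup H] [InnerProductSpace ℝ H] [CompleteSpace H]
  {Y : Ξ → H}

lemma lintegral_enorm_add_sq (hY : Integrable Y μ) (hY₀ : ∫ ξ, Y ξ ∂μ = 0) (w : H) :
    ∫⁻ ξ, ‖w + Y ξ‖ₑ ^ 2 ∂μ = ‖w‖ₑ ^ 2 + ∫⁻ ξ, ‖Y ξ‖ₑ ^ 2 ∂μ := by
  have hwY : AEStronglyMeasurable (fun ξ => w + Y ξ) μ := aestronglyMeasurable_const.add hY.1
  by_cases hY₂ : MemLp Y 2 μ
  · have hsq : Integrable (fun ξ => ‖Y ξ‖ ^ 2) μ := (memLp_two_iff_integrable_sq_norm hY.1).1 hY₂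
    have hinner : Integrable (fun ξ => 2 * inner ℝ w (Y ξ)) μ := (hY.const_inner w).const_mul 2
    have hinner₀ : ∫ ξ, 2 * inner ℝ w (Y ξ) ∂μ = 0 := by
      rw [integral_const_mul, integral_inner hY, hY₀, inner_zero_right, mul_zero]
    have hreal : ∫ ξ, ‖w + Y ξ‖ ^ 2 ∂μ = ‖w‖ ^ 2 + ∫ ξ, ‖Y ξ‖ ^ 2 ∂μ := by
      simp_rw [norm_add_sq_real]
      rw [integral_add (f := fun ξ => ‖w‖ ^ 2 + 2 * inner ℝ w (Y ξ))
          ((integrable_const _).add hinner) hsq,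
        integral_add (integrable_const _) hinner, hinner₀, integral_const, probReal_univ, one_smul,
        add_zero]
    simp_rw [enorm_sq_eq_ofReal]
    rw [← ofReal_integral_eq_lintegral_ofReal
        ((memLp_two_iff_integrable_sq_norm hwY).1 ((memLp_const w).add hY₂))
        (.of_forall fun ξ => sq_nonneg _),
      ← ofReal_integral_eq_lintegral_ofReal hsq (.of_forall fun ξ => sq_nonneg _), hreal,
      ENNReal.ofReal_add (sq_nonneg _) (integral_nonneg fun ξ => sq_nonneg _)]
  · have hwY₂ : ¬MemLp (fun ξ => w + Y ξ) 2 μ := fun h =>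
      hY₂ ((h.sub (memLp_const w)).ae_eq (.of_forall fun ξ => add_sub_cancel_left w (Y ξ)))
    rw [← lintegral_enorm_sq_lt_top_iff hY.1, not_lt_top_iff] at hY₂
    rw [← lintegral_enorm_sq_lt_top_iff hwY, not_lt_top_iff] at hwY₂
    rw [hwY₂, hY₂, add_top]

lemma integral_sub_integral {X : Ξ → H} (hX : Integrable X μ) :
    ∫ ξ, (X ξ - ∫ ζ, X ζ ∂μ) ∂μ = 0 := by
  rw [integral_sub hX (integrable_const _), integral_const, probReal_univ, one_smul, sub_self]

lemma lintegral_enorm_sub_integral_sq_le {X : Ξ → H} (hX : Integrable X μ) :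
    ∫⁻ ξ, ‖X ξ - ∫ ζ, X ζ ∂μ‖ₑ ^ 2 ∂μ ≤ ∫⁻ ξ, ‖X ξ‖ₑ ^ 2 ∂μ := by
  have h := lintegral_enorm_add_sq (hX.sub (integrable_const _)) (integral_sub_integral hX)
    (∫ ζ, X ζ ∂μ)
  simp only [Pi.sub_apply, add_sub_cancel] at h
  exact h ▸ le_add_self

lemma lintegral_pi_enorm_add_sum_sq_le (hY : Integrable Y μ) (hY₀ : ∫ ξ, Y ξ ∂μ = 0) (m : ℕ)
    (w : H) :
    ∫⁻ ξ : Fin m → Ξ, ‖w + ∑ i, Y (ξ i)‖ₑ ^ 2 ∂(Measure.pi fun _ => μ)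
      ≤ ‖w‖ₑ ^ 2 + m * ∫⁻ ξ, ‖Y ξ‖ₑ ^ 2 ∂μ := by
  induction m generalizing w with
  | zero => simp
  | succ m ih =>
    set v := ∫⁻ ξ, ‖Y ξ‖ₑ ^ 2 ∂μ
    calc ∫⁻ ξ : Fin (m + 1) → Ξ, ‖w + ∑ i, Y (ξ i)‖ₑ ^ 2 ∂(Measure.pi fun _ => μ)
        ≤ ∫⁻ a, ∫⁻ ξ : Fin m → Ξ, ‖w + ∑ i, Y ((Fin.cons a ξ : Fin (m + 1) → Ξ) i)‖ₑ ^ 2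
          ∂(Measure.pi fun _ => μ) ∂μ := lintegral_pi_succ_le μ _
      _ ≤ ∫⁻ a, (‖w + Y a‖ₑ ^ 2 + m * v) ∂μ := by
          refine lintegral_mono fun a => ?_
          simp only [Fin.sum_univ_succ, Fin.cons_zero, Fin.cons_succ, ← add_assoc]
          exact ih _
      _ = ‖w‖ₑ ^ 2 + v + m * v := by
          rw [lintegral_add_right _ measurable_const, lintegral_const, measure_univ, mul_one,
            lintegral_enorm_add_sq hY hY₀]
      _ = ‖w‖ₑ ^ 2 + (m + 1 : ℕ) * v := by push_cast; ring

lemma lintegral_pi_enorm_add_mean_sub_integral_sq_le {X : Ξ → H} (hX : Integrable X μ) {m : ℕ}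
    (hm : 0 < m) (w : H) :
    ∫⁻ ξ : Fin m → Ξ, ‖w + ((m : ℝ)⁻¹ • ∑ i, X (ξ i) - ∫ ζ, X ζ ∂μ)‖ₑ ^ 2
        ∂(Measure.pi fun _ => μ)
      ≤ ‖w‖ₑ ^ 2 + (∫⁻ ξ, ‖X ξ - ∫ ζ, X ζ ∂μ‖ₑ ^ 2 ∂μ) / m := by
  have hm₀ : (m : ENNReal) ≠ 0 := Nat.cast_ne_zero.2 hm.ne'
  have hscale (x : H) : ‖(m : ℝ)⁻¹ • x‖ₑ ^ 2 = ((m : ENNReal)⁻¹) ^ 2 * ‖x‖ₑ ^ 2 := by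
    rw [enorm_smul, mul_pow, enorm_inv (Nat.cast_ne_zero.2 hm.ne'), Real.enorm_natCast]
  have hsum := lintegral_pi_enorm_add_sum_sq_le
    (Y := fun ξ => (m : ℝ)⁻¹ • (X ξ - ∫ ζ, X ζ ∂μ)) ((hX.sub (integrable_const _)).smul _)
    (by rw [integral_smul, integral_sub_integral hX, smul_zero]) m w
  simp_rw [← Finset.smul_sum, inv_smul_sum_sub hm, hscale] at hsum
  have hcancel : (m : ENNReal) * (m : ENNReal)⁻¹ ^ 2 = (m : ENNReal)⁻¹ := by
    rw [sq, ← mul_assoc, ENNReal.mul_inv_cancel hm₀ (ENNReal.natCast_ne_top m), one_mul]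
  rwa [lintegral_const_mul' _ _ (ENNReal.pow_ne_top (ENNReal.inv_ne_top.2 hm₀)), ← mul_assoc,
    hcancel, ← ENNReal.div_eq_inv_mul] at hsum

-- With `Z = Y - T X`, the error of the recursive estimator is `T (g - 𝔼 X)` plus the centred
-- mean of the samples of `Z`, whose variance is at most `R² / m`.
lemma lintegral_pi_enorm_recursive_estimate_sub_sq_le {H₁ : Type*} [NormedAddCommGroup H₁]
    [InnerProductSpace ℝ H₁] [CompleteSpace H₁] {T : H →L[ℝ] H₁} (hT : ∀ w, ‖T w‖ ≤ ‖w‖)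
    {X : Ξ → H} {Y : Ξ → H₁} (hX : Integrable X μ) (hY : Integrable Y μ) {R : ℝ}
    (hR : ∀ ξ, ‖Y ξ - T (X ξ)‖ ≤ R) {m : ℕ} (hm : 0 < m) (g : H) :
    ∫⁻ ξ : Fin m → Ξ, ‖T g + (m : ℝ)⁻¹ • ∑ i, Y (ξ i) - T ((m : ℝ)⁻¹ • ∑ i, X (ξ i))
        - ∫ ζ, Y ζ ∂μ‖ₑ ^ 2 ∂(Measure.pi fun _ => μ)
      ≤ ‖g - ∫ ζ, X ζ ∂μ‖ₑ ^ 2 + ENNReal.ofReal (R ^ 2) / m := by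
  set Z : Ξ → H₁ := fun ξ => Y ξ - T (X ξ)
  have hTX : Integrable (fun ξ => T (X ξ)) μ := T.integrable_comp hX
  have hZ : Integrable Z μ := hY.sub hTX
  have hZ_int : ∫ ζ, Z ζ ∂μ = ∫ ζ, Y ζ ∂μ - T (∫ ζ, X ζ ∂μ) := by
    rw [← T.integral_comp_comm hX, ← integral_sub hY hTX]
  have herror (ξ : Fin m → Ξ) :
      T g + (m : ℝ)⁻¹ • ∑ i, Y (ξ i) - T ((m : ℝ)⁻¹ • ∑ i, X (ξ i)) - ∫ ζ, Y ζ ∂μ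
        = T (g - ∫ ζ, X ζ ∂μ) + ((m : ℝ)⁻¹ • ∑ i, Z (ξ i) - ∫ ζ, Z ζ ∂μ) := by
    simp only [Z, hZ_int, Finset.sum_sub_distrib, smul_sub, map_sub, map_smul, map_sum]
    abel
  have hvar : ∫⁻ ξ, ‖Z ξ - ∫ ζ, Z ζ ∂μ‖ₑ ^ 2 ∂μ ≤ ENNReal.ofReal (R ^ 2) := by
    calc ∫⁻ ξ, ‖Z ξ - ∫ ζ, Z ζ ∂μ‖ₑ ^ 2 ∂μ
        ≤ ∫⁻ ξ, ‖Z ξ‖ₑ ^ 2 ∂μ := lintegral_enorm_sub_integral_sq_le hZ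
      _ ≤ ∫⁻ _, ENNReal.ofReal (R ^ 2) ∂μ := lintegral_mono fun ξ => by
          rw [enorm_sq_eq_ofReal]
          gcongr
          exact hR ξ
      _ = ENNReal.ofReal (R ^ 2) := by rw [lintegral_const, measure_univ, mul_one]
  simp_rw [herror]
  refine (lintegral_pi_enorm_add_mean_sub_integral_sq_le hZ hm _).trans ?_
  gcongr
  exact enorm_le_iff_norm_le.2 (hT _)

end SampleMeans

section Orbits

variable {α S : Type*}

/-- The orbit `z, T z (s 0), T (T z (s 0)) (s 1), …` of `z` under a map `T` driven by a finite
sequence of inputs. The iterates of the algorithm are of this form. -/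
def orbit (T : α → S → α) (z : α) {K : ℕ} (s : Fin K → S) : Fin (K + 1) → α :=
  Fin.induction (motive := fun _ => α) z (fun k w => T w (s k))

lemma orbit_cons_succ (T : α → S → α) (z : α) {K : ℕ} (a : S) (s : Fin K → S) (i : Fin (K + 1)) :
    orbit T z (Fin.cons a s : Fin (K + 1) → S) i.succ = orbit T (T z a) s i := by
  induction i using Fin.induction with
  | zero => rfl
  | succ j ih =>
    change T (orbit T z (Fin.cons a s : Fin (K + 1) → S) j.castSucc.succ) (s j) = _
    rw [ih]
    rfl

lemma sum_orbit_cons {A : Type*} [AddCommMonoid A] (T : α → S → α) (h : α → A) (z : α) {K : ℕ}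
    (a : S) (s : Fin K → S) :
    ∑ i : Fin (K + 1), h (orbit T z (Fin.cons a s : Fin (K + 1) → S) i.castSucc)
      = h z + ∑ i : Fin K, h (orbit T (T z a) s i.castSucc) := by
  rw [Fin.sum_univ_succ]
  simp_rw [← orbit_cons_succ T z a s, Fin.succ_castSucc]
  rfl

variable [MeasurableSpace S]

lemma lintegral_pi_sum_orbit_le {ν : Measure S} [IsProbabilityMeasure ν] {T : α → S → α}
    {h Φ : α → ENNReal} {C : ENNReal} (hstep : ∀ z, h z + ∫⁻ s, Φ (T z s) ∂ν ≤ Φ z + C) (K : ℕ)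
    (z : α) :
    ∫⁻ s : Fin K → S, ∑ i : Fin K, h (orbit T z s i.castSucc) ∂(Measure.pi fun _ => ν)
      ≤ Φ z + K * C := by
  induction K generalizing z with
  | zero => simp
  | succ K ih =>
    calc ∫⁻ s : Fin (K + 1) → S, ∑ i : Fin (K + 1), h (orbit T z s i.castSucc)
          ∂(Measure.pi fun _ => ν)
        ≤ ∫⁻ a, ∫⁻ s : Fin K → S,
            ∑ i : Fin (K + 1), h (orbit T z (Fin.cons a s : Fin (K + 1) → S) i.castSucc)
          ∂(Measure.pi fun _ => ν) ∂ν := lintegral_pi_succ_le ν _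
      _ ≤ ∫⁻ a, (h z + K * C) + Φ (T z a) ∂ν := by
          refine lintegral_mono fun a => ?_
          simp_rw [sum_orbit_cons]
          rw [lintegral_add_left measurable_const, lintegral_const, measure_univ, mul_one,
            add_assoc, add_comm (K * C)]
          gcongr
          exact ih _
      _ = K * C + (h z + ∫⁻ a, Φ (T z a) ∂ν) := by
          rw [lintegral_add_left measurable_const, lintegral_const, measure_univ, mul_one]
          ring
      _ ≤ K * C + (Φ z + C) := by grw [hstep z]
      _ = Φ z + (K + 1 : ℕ) * C := by push_cast; ring

end Orbits

section ProductMeasures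

variable {S ι : Type*} [MeasurableSpace S]

lemma sum_lintegral_le_lintegral_sum (μ : Measure S) (t : Finset ι) (h : ι → S → ENNReal) :
    ∑ i ∈ t, ∫⁻ s, h i s ∂μ ≤ ∫⁻ s, ∑ i ∈ t, h i s ∂μ := by
  classical
  induction t using Finset.induction_on with
  | empty => simp
  | insert i t hi ih =>
    simp_rw [Finset.sum_insert hi]
    grw [ih]
    exact le_lintegral_add _ _

variable [Fintype ι]

lemma lintegral_uniformOn_prod_le [MeasurableSpace ι] [MeasurableSingletonClass ι]
    (μ : Measure S) (h : ι → S → ENNReal) :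
    ∫⁻ q : ι × S, h q.1 q.2 ∂((ProbabilityTheory.uniformOn Set.univ).prod μ)
      ≤ (Fintype.card ι : ENNReal)⁻¹ * ∫⁻ s, ∑ i, h i s ∂μ := by
  refine (lintegral_prod_le _).trans ?_
  rw [ProbabilityTheory.uniformOn, ProbabilityTheory.cond, lintegral_smul_measure,
    Measure.restrict_univ, lintegral_count, tsum_fintype, Measure.count_univ, smul_eq_mul,
    ENat.card_eq_coe_fintype_card, ENat.toENNReal_coe]
  gcongr
  exact sum_lintegral_le_lintegral_sum μ _ _

lemma lintegral_pi_sum_eval (ν : Measure S) [IsProbabilityMeasure ν] {h : S → ENNReal}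
    (hh : Measurable h) :
    ∫⁻ s : ι → S, ∑ i, h (s i) ∂(Measure.pi fun _ => ν)
      = Fintype.card ι * ∫⁻ s, h s ∂ν := by
  have hmeas (i : ι) : Measurable fun s : ι → S => h (s i) := hh.comp (measurable_pi_apply i)
  rw [lintegral_finsetSum _ fun i _ => hmeas i]
  simp_rw [(measurePreserving_eval (fun _ : ι => ν) _).lintegral_comp hh]
  rw [Finset.sum_const, Finset.card_univ, nsmul_eq_mul]

end ProductMeasures

section StepLaw

variable {Ξ : Type*} [MeasurableSpace Ξ] {D : Measure Ξ} [IsProbabilityMeasure D]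
  {B b K : ℕ} {p : ℝ}

lemma isProbabilityMeasure_coin (hp₀ : 0 ≤ p) (hp₁ : p ≤ 1) :
    IsProbabilityMeasure (ENNReal.ofReal p • Measure.dirac true
      + ENNReal.ofReal (1 - p) • Measure.dirac false : Measure Bool) := by
  constructor
  simp only [Measure.add_apply, Measure.smul_apply, measure_univ, smul_eq_mul, mul_one]
  rw [← ENNReal.ofReal_add hp₀ (sub_nonneg.2 hp₁), add_sub_cancel, ENNReal.ofReal_one]

lemma isProbabilityMeasure_stepLaw (hp₀ : 0 ≤ p) (hp₁ : p ≤ 1) :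
    IsProbabilityMeasure (stepLaw D B b p) := by
  have := isProbabilityMeasure_coin hp₀ hp₁
  unfold stepLaw
  infer_instance

lemma isProbabilityMeasure_runLaw (hp₀ : 0 ≤ p) (hp₁ : p ≤ 1) :
    IsProbabilityMeasure (runLaw D B b p K) := by
  have := isProbabilityMeasure_stepLaw (D := D) (B := B) (b := b) hp₀ hp₁
  unfold runLaw
  infer_instance

lemma lintegral_stepLaw_le (h₁ : (Fin B → Ξ) → ENNReal) (h₂ : (Fin b → Ξ) → ENNReal) :
    ∫⁻ s, (if s.1 = true then h₁ s.2.1 else h₂ s.2.2) ∂(stepLaw D B b p) ≤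
      ENNReal.ofReal p * ∫⁻ ζ, h₁ ζ ∂(Measure.pi fun _ => D)
        + ENNReal.ofReal (1 - p) * ∫⁻ ξ, h₂ ξ ∂(Measure.pi fun _ => D) := by
  refine (lintegral_prod_le _).trans ?_
  rw [lintegral_add_measure, lintegral_smul_measure, lintegral_smul_measure, lintegral_dirac,
    lintegral_dirac, smul_eq_mul, smul_eq_mul]
  gcongr
  · refine (lintegral_prod_le _).trans (le_of_eq ?_)
    simp
  · refine (lintegral_prod_le _).trans (le_of_eq ?_)
    simp

lemma lintegral_stepCost_le (hp₀ : 0 ≤ p) (hp₁ : p ≤ 1) :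
    ∫⁻ s, (if s.1 = true then (B : ENNReal) else 2 * b) ∂(stepLaw D B b p)
      ≤ ENNReal.ofReal (p * B + (1 - p) * (2 * b)) := by
  have hp₁' := sub_nonneg.2 hp₁
  refine (lintegral_stepLaw_le (fun _ => (B : ENNReal)) (fun _ => 2 * b)).trans (le_of_eq ?_)
  rw [ENNReal.ofReal_add (by positivity) (by positivity), ENNReal.ofReal_mul hp₀,
    ENNReal.ofReal_mul hp₁', ENNReal.ofReal_mul zero_le_two]
  simp

lemma lintegral_gradCount_le (hp₀ : 0 ≤ p) (hp₁ : p ≤ 1) :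
    ∫⁻ r, (gradCount r : ENNReal) ∂(runLaw D B b p K) ≤
      ENNReal.ofReal (B + K * (p * B + (1 - p) * (2 * b))) := by
  have := isProbabilityMeasure_stepLaw (D := D) (B := B) (b := b) hp₀ hp₁
  have : 0 ≤ 1 - p := sub_nonneg.2 hp₁
  have hmeas : Measurable fun s : StepSample Ξ B b =>
      if s.1 = true then (B : ENNReal) else 2 * b :=
    .ite (measurable_fst (measurableSet_singleton true)) measurable_const measurable_const
  have hcount (ζ : Fin B → Ξ) (s : Fin K → StepSample Ξ B b) : (gradCount (ζ, s) : ENNReal)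
      = B + ∑ k, if (s k).1 = true then (B : ENNReal) else 2 * b := by
    simp [gradCount]
  refine (lintegral_prod_le _).trans ?_
  simp_rw [hcount]
  rw [lintegral_const, measure_univ, mul_one, lintegral_add_left measurable_const,
    lintegral_const, measure_univ, mul_one, lintegral_pi_sum_eval _ hmeas, Fintype.card_fin,
    ENNReal.ofReal_add (by positivity) (by positivity), ENNReal.ofReal_natCast,
    ENNReal.ofReal_mul (by positivity), ENNReal.ofReal_natCast]
  gcongr
  exact lintegral_stepCost_le hp₀ hp₁

end StepLaw

section EstimatorError

variable {E : Type*} [NormedAddCommGroup E] [NormedSpace ℝ E] [FiniteDimensional ℝ E]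
  {M : Type*} [TopologicalSpace M] [ChartedSpace E M]
  [RiemannianBundle (fun x : M => TangentSpace 𝓘(ℝ, E) x)]
  {Ξ : Type*} [MeasurableSpace Ξ]

variable (E) in
/-- The stochastic gradient `∇F(x, ξ)`, with `ξ` distributed as `D`, has mean squared distance at
most `σ²` from `∇f(x)` for all `x`. A lower integral is used, so that the bound also asserts that
this quantity is finite. -/
def HasBoundedGradVariance (D : Measure Ξ) (F : M → Ξ → ℝ) (f : M → ℝ) (σ : ℝ) : Prop :=
  ∀ x, ∫⁻ ξ, ‖grad (E := E) (fun y => F y ξ) x - grad f x‖ₑ ^ 2 ∂D ≤ ENNReal.ofReal (σ ^ 2)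

variable {D : Measure Ξ} [IsProbabilityMeasure D] {F : M → Ξ → ℝ} {f : M → ℝ} {L σ η p : ℝ}
  {B b : ℕ}

lemma lintegral_batchGrad_sub_grad_sq_le (hgrad : IsUnbiasedGrad E D F f)
    (hvar : HasBoundedGradVariance E D F f σ) (hB : 0 < B) (x : M) :
    ∫⁻ ζ : Fin B → Ξ, ‖batchGrad E F ζ x - grad f x‖ₑ ^ 2 ∂(Measure.pi fun _ => D)
      ≤ ENNReal.ofReal (σ ^ 2 / B) := by
  have hmean := lintegral_pi_enorm_add_mean_sub_integral_sq_le (hgrad.integrable x) hB 0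
  simp only [hgrad.integral_eq, zero_add, enorm_zero, ne_eq, OfNat.ofNat_ne_zero,
    not_false_eq_true, zero_pow] at hmean
  grw [hvar x] at hmean
  rwa [ENNReal.ofReal_div_of_pos (Nat.cast_pos.2 hB), ENNReal.ofReal_natCast]

variable [IsManifold 𝓘(ℝ, E) ∞ M]
  [IsContMDiffRiemannianBundle 𝓘(ℝ, E) ∞ E (fun x : M => TangentSpace 𝓘(ℝ, E) x)]

lemma lintegral_recursive_estimator_sub_grad_sq_le (hM : GeodesicallyComplete E M)
    (hsmooth : ∀ ξ, IsGeodesicallySmooth E L (fun x => F x ξ)) (hgrad : IsUnbiasedGrad E D F f)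
    (hb : 0 < b) {v : TangentBundle 𝓘(ℝ, E) M} {g : TangentSpace 𝓘(ℝ, E) v.proj}
    (hg : g ∈ Submodule.span ℝ {v.snd}) :
    ∫⁻ ξ : Fin b → Ξ, ‖transport v g + batchGrad E F ξ (expMap v)
        - transport v (batchGrad E F ξ v.proj) - grad f (expMap v)‖ₑ ^ 2
        ∂(Measure.pi fun _ => D)
      ≤ ‖g - grad f v.proj‖ₑ ^ 2 + ENNReal.ofReal ((L * ‖v.snd‖) ^ 2 / b) := by
  obtain ⟨S, T, hT, hTS, hv, hsmoothS⟩ := hM.exists_transport_clm v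
  have hgS : g ∈ S := (Submodule.span_singleton_le_iff_mem _ _).2 hv hg
  have hbatchS (ξ : Fin b → Ξ) : batchGrad E F ξ v.proj ∈ S :=
    S.smul_mem _ (S.sum_mem fun i _ => (hsmoothS L _ (hsmooth (ξ i))).1)
  have h := lintegral_pi_enorm_recursive_estimate_sub_sq_le hT (hgrad.integrable v.proj)
    (hgrad.integrable (expMap v)) (fun ξ => (hsmoothS L _ (hsmooth ξ)).2) hb g
  rw [hgrad.integral_eq, hgrad.integral_eq, ← ENNReal.ofReal_natCast,
    ← ENNReal.ofReal_div_of_pos (Nat.cast_pos.2 hb)] at h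
  simp_rw [hTS _ hgS, hTS _ (hbatchS _)]
  exact h

lemma lintegral_step_snd_sub_grad_sq_le (hM : GeodesicallyComplete E M)
    (hsmooth : ∀ ξ, IsGeodesicallySmooth E L (fun x => F x ξ)) (hgrad : IsUnbiasedGrad E D F f)
    (hvar : HasBoundedGradVariance E D F f σ) (hB : 0 < B) (hb : 0 < b) (hη : 0 < η)
    (z : TangentBundle 𝓘(ℝ, E) M) :
    ∫⁻ s : StepSample Ξ B b, ‖(step F η z s).snd - grad f (step F η z s).proj‖ₑ ^ 2
        ∂(stepLaw D B b p)
      ≤ ENNReal.ofReal p * ENNReal.ofReal (σ ^ 2 / B)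
        + ENNReal.ofReal (1 - p) * (‖z.snd - grad f z.proj‖ₑ ^ 2
          + ENNReal.ofReal ((L * (η * ‖z.snd‖)) ^ 2 / b)) := by
  set v : TangentBundle 𝓘(ℝ, E) M := ⟨z.proj, -(η • z.snd)⟩
  have hnorm : ‖v.snd‖ = η * ‖z.snd‖ := by
    rw [← Real.norm_of_nonneg hη.le, ← norm_smul]
    exact norm_neg (η • z.snd)
  have hz : z.snd ∈ Submodule.span ℝ {v.snd} :=
    Submodule.mem_span_singleton.2 ⟨-η⁻¹, by
      change -η⁻¹ • -(η • z.snd) = z.snd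
      rw [neg_smul_neg, inv_smul_smul₀ hη.ne']⟩
  have hrec := lintegral_recursive_estimator_sub_grad_sq_le hM hsmooth hgrad hb hz
  rw [hnorm] at hrec
  have hbatch := lintegral_batchGrad_sub_grad_sq_le hgrad hvar hB (expMap v)
  have hsplit (s : StepSample Ξ B b) :
      ‖(step F η z s).snd - grad f (step F η z s).proj‖ₑ ^ 2
        = if s.1 = true then ‖batchGrad E F s.2.1 (expMap v) - grad f (expMap v)‖ₑ ^ 2
          else ‖transport v z.snd + batchGrad E F s.2.2 (expMap v)
            - transport v (batchGrad E F s.2.2 v.proj) - grad f (expMap v)‖ₑ ^ 2 := by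
    obtain ⟨_ | _, _⟩ := s <;> rfl
  simp_rw [hsplit]
  grw [lintegral_stepLaw_le (fun ζ => ‖batchGrad E F ζ (expMap v) - grad f (expMap v)‖ₑ ^ 2)
    (fun ξ => ‖transport v z.snd + batchGrad E F ξ (expMap v)
      - transport v (batchGrad E F ξ v.proj) - grad f (expMap v)‖ₑ ^ 2), hbatch, hrec]

end EstimatorError

section Convergence

lemma lyapunov_descent {H : Type*} [NormedAddCommGroup H] [InnerProductSpace ℝ H] {G g : H}
    {L η p a b f₀ f₁ : ℝ} (hη : 0 < η) (hp : 0 < p) (hb : 0 < b)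
    (hstep : (1 - p) / (p * b) * (L * η) ^ 2 + L * η ≤ 1)
    (hdesc : f₁ ≤ f₀ + inner ℝ G (-(η • g)) + L / 2 * ‖-(η • g)‖ ^ 2) :
    η / 2 * ‖G‖ ^ 2
        + (f₁ + η / (2 * p) * (p * a + (1 - p) * (‖g - G‖ ^ 2 + (L * (η * ‖g‖)) ^ 2 / b)))
      ≤ f₀ + η / (2 * p) * ‖g - G‖ ^ 2 + η / 2 * a := by
  have hinner : inner ℝ G (-(η • g)) = -(η * inner ℝ G g) := by
    rw [inner_neg_right, real_inner_smul_right]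
  have hnorm : ‖-(η • g)‖ ^ 2 = η ^ 2 * ‖g‖ ^ 2 := by
    rw [norm_neg, norm_smul, mul_pow, Real.norm_eq_abs, sq_abs]
  have hpolar : ‖g - G‖ ^ 2 = ‖g‖ ^ 2 - 2 * inner ℝ G g + ‖G‖ ^ 2 := by
    rw [norm_sub_sq_real, real_inner_comm]
  have hexpand : η / (2 * p) * (p * a + (1 - p) * (‖g - G‖ ^ 2 + (L * (η * ‖g‖)) ^ 2 / b))
      = η / 2 * a + (η / (2 * p) * ‖g - G‖ ^ 2 - η / 2 * ‖g - G‖ ^ 2)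
        + η / 2 * ‖g‖ ^ 2 * ((1 - p) / (p * b) * (L * η) ^ 2) := by
    field_simp
    ring
  have hcoeff := mul_le_mul_of_nonneg_left hstep (show 0 ≤ η / 2 * ‖g‖ ^ 2 by positivity)
  rw [hinner, hnorm] at hdesc
  rw [hexpand]
  linear_combination hdesc + hcoeff - η / 2 * hpolar

variable {E : Type*} [NormedAddCommGroup E] [NormedSpace ℝ E] [FiniteDimensional ℝ E]
  {M : Type*} [TopologicalSpace M] [ChartedSpace E M]
  [RiemannianBundle (fun x : M => TangentSpace 𝓘(ℝ, E) x)]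

/-- The Lyapunov function of the method at the state `(x, g)`: the optimality gap `f(x) - f*` plus
`c` times the squared error of `g` as an estimate of `∇f(x)`. -/
def lyapunov (f : M → ℝ) (fstar c : ℝ) (z : TangentBundle 𝓘(ℝ, E) M) : ENNReal :=
  ENNReal.ofReal (f z.proj - fstar) + ENNReal.ofReal c * ‖z.snd - grad f z.proj‖ₑ ^ 2

variable {Ξ : Type*} [MeasurableSpace Ξ] {D : Measure Ξ} [IsProbabilityMeasure D]
  {F : M → Ξ → ℝ} {f : M → ℝ} {L σ η p c fstar : ℝ} {B b K : ℕ}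

lemma lintegral_lyapunov_initial_le (hgrad : IsUnbiasedGrad E D F f)
    (hvar : HasBoundedGradVariance E D F f σ) (hfstar : ∀ x, fstar ≤ f x) (hc : 0 ≤ c)
    (hB : 0 < B) (x : M) :
    ∫⁻ ζ : Fin B → Ξ, lyapunov f fstar c ⟨x, batchGrad E F ζ x⟩ ∂(Measure.pi fun _ => D)
      ≤ ENNReal.ofReal (f x - fstar + c * (σ ^ 2 / B)) := by
  have hx := sub_nonneg.2 (hfstar x)
  simp only [lyapunov]
  rw [lintegral_add_left measurable_const, lintegral_const, measure_univ, mul_one,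
    lintegral_const_mul' _ _ ENNReal.ofReal_ne_top, ENNReal.ofReal_add hx (by positivity),
    ENNReal.ofReal_mul hc]
  gcongr
  exact lintegral_batchGrad_sub_grad_sq_le hgrad hvar hB x

variable [IsManifold 𝓘(ℝ, E) ∞ M]
  [IsContMDiffRiemannianBundle 𝓘(ℝ, E) ∞ E (fun x : M => TangentSpace 𝓘(ℝ, E) x)]

lemma lintegral_lyapunov_step_le (hM : GeodesicallyComplete E M)
    (hsmooth : ∀ ξ, IsGeodesicallySmooth E L (fun x => F x ξ)) (hgrad : IsUnbiasedGrad E D F f)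
    (hvar : HasBoundedGradVariance E D F f σ) (hB : 0 < B) (hb : 0 < b) (hη : 0 < η)
    (hp₀ : 0 ≤ p) (hp₁ : p ≤ 1) (z : TangentBundle 𝓘(ℝ, E) M) :
    ∫⁻ s : StepSample Ξ B b, lyapunov f fstar c (step F η z s) ∂(stepLaw D B b p) ≤
      ENNReal.ofReal (f (expMap ⟨z.proj, -(η • z.snd)⟩) - fstar)
        + ENNReal.ofReal c * (ENNReal.ofReal p * ENNReal.ofReal (σ ^ 2 / B)
          + ENNReal.ofReal (1 - p) * (‖z.snd - grad f z.proj‖ₑ ^ 2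
            + ENNReal.ofReal ((L * (η * ‖z.snd‖)) ^ 2 / b))) := by
  have := isProbabilityMeasure_stepLaw (D := D) (B := B) (b := b) hp₀ hp₁
  have hproj (s : StepSample Ξ B b) :
      f (step F η z s).proj = f (expMap ⟨z.proj, -(η • z.snd)⟩) := rfl
  simp_rw [lyapunov, hproj]
  rw [lintegral_add_left measurable_const, lintegral_const, measure_univ, mul_one,
    lintegral_const_mul' _ _ ENNReal.ofReal_ne_top]
  gcongr
  exact lintegral_step_snd_sub_grad_sq_le hM hsmooth hgrad hvar hB hb hη z

lemma grad_sq_add_lintegral_lyapunov_step_le (hM : GeodesicallyComplete E M)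
    (hsmooth : ∀ ξ, IsGeodesicallySmooth E L (fun x => F x ξ))
    (hquad : HasQuadraticUpperBound E L f) (hgrad : IsUnbiasedGrad E D F f)
    (hvar : HasBoundedGradVariance E D F f σ) (hfstar : ∀ x, fstar ≤ f x)
    (hB : 0 < B) (hb : 0 < b) (hη : 0 < η) (hp₀ : 0 < p) (hp₁ : p ≤ 1)
    (hstep : (1 - p) / (p * b) * (L * η) ^ 2 + L * η ≤ 1) (z : TangentBundle 𝓘(ℝ, E) M) :
    ENNReal.ofReal (η / 2) * ‖grad (E := E) f z.proj‖ₑ ^ 2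
        + ∫⁻ s : StepSample Ξ B b, lyapunov f fstar (η / (2 * p)) (step F η z s)
            ∂(stepLaw D B b p)
      ≤ lyapunov f fstar (η / (2 * p)) z + ENNReal.ofReal (η / 2 * (σ ^ 2 / B)) := by
  grw [lintegral_lyapunov_step_le hM hsmooth hgrad hvar hB hb hη hp₀.le hp₁ z, lyapunov]
  have hp₁' := sub_nonneg.2 hp₁
  have hx := sub_nonneg.2 (hfstar z.proj)
  have hy := sub_nonneg.2 (hfstar (expMap ⟨z.proj, -(η • z.snd)⟩))
  simp (disch := positivity) only [enorm_sq_eq_ofReal, ← ENNReal.ofReal_mul, ← ENNReal.ofReal_add]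
  refine ENNReal.ofReal_le_ofReal (lyapunov_descent hη hp₀ (Nat.cast_pos.2 hb) hstep ?_)
  linear_combination hquad ⟨z.proj, -(η • z.snd)⟩

lemma lintegral_sum_grad_iterates_sq_le (hM : GeodesicallyComplete E M)
    (hsmooth : ∀ ξ, IsGeodesicallySmooth E L (fun x => F x ξ))
    (hquad : HasQuadraticUpperBound E L f) (hgrad : IsUnbiasedGrad E D F f)
    (hvar : HasBoundedGradVariance E D F f σ) (hfstar : ∀ x, fstar ≤ f x)
    (hB : 0 < B) (hb : 0 < b) (hη : 0 < η) (hp₀ : 0 < p) (hp₁ : p ≤ 1)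
    (hstep : (1 - p) / (p * b) * (L * η) ^ 2 + L * η ≤ 1) (x₀ : M) :
    ENNReal.ofReal (η / 2) * ∫⁻ r, ∑ i : Fin K,
        ‖grad (E := E) f (iterates (E := E) F η x₀ r i.castSucc).proj‖ₑ ^ 2
          ∂(runLaw D B b p K)
      ≤ ENNReal.ofReal (f x₀ - fstar + η / (2 * p) * (σ ^ 2 / B)
          + K * (η / 2 * (σ ^ 2 / B))) := by
  have := isProbabilityMeasure_stepLaw (D := D) (B := B) (b := b) hp₀.le hp₁
  have hδ := sub_nonneg.2 (hfstar x₀)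
  have hrun := lintegral_pi_sum_orbit_le (T := step F η)
    (h := fun z => ENNReal.ofReal (η / 2) * ‖grad (E := E) f z.proj‖ₑ ^ 2)
    (grad_sq_add_lintegral_lyapunov_step_le hM hsmooth hquad hgrad hvar hfstar hB hb hη hp₀ hp₁
      hstep) K
  calc ENNReal.ofReal (η / 2) * ∫⁻ r, ∑ i : Fin K,
          ‖grad (E := E) f (iterates (E := E) F η x₀ r i.castSucc).proj‖ₑ ^ 2
            ∂(runLaw D B b p K)
      = ∫⁻ r, ∑ i : Fin K, ENNReal.ofReal (η / 2)
          * ‖grad (E := E) f (iterates (E := E) F η x₀ r i.castSucc).proj‖ₑ ^ 2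
            ∂(runLaw D B b p K) := by
        simp_rw [← Finset.mul_sum]
        exact (lintegral_const_mul' _ _ ENNReal.ofReal_ne_top).symm
    _ ≤ ∫⁻ ζ : Fin B → Ξ, (lyapunov f fstar (η / (2 * p)) ⟨x₀, batchGrad E F ζ x₀⟩
          + K * ENNReal.ofReal (η / 2 * (σ ^ 2 / B))) ∂(Measure.pi fun _ => D) :=
        (lintegral_prod_le _).trans (lintegral_mono fun ζ => hrun ⟨x₀, batchGrad E F ζ x₀⟩)
    _ ≤ ENNReal.ofReal (f x₀ - fstar + η / (2 * p) * (σ ^ 2 / B)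
          + K * (η / 2 * (σ ^ 2 / B))) := by
        rw [lintegral_add_right _ measurable_const, lintegral_const, measure_univ, mul_one]
        grw [lintegral_lyapunov_initial_le hgrad hvar hfstar (by positivity) hB x₀]
        rw [← ENNReal.ofReal_natCast, ← ENNReal.ofReal_mul (Nat.cast_nonneg K),
          ← ENNReal.ofReal_add (by positivity) (by positivity)]

lemma lintegral_grad_uniform_iterate_sq_le (hM : GeodesicallyComplete E M)
    (hsmooth : ∀ ξ, IsGeodesicallySmooth E L (fun x => F x ξ))
    (hquad : HasQuadraticUpperBound E L f) (hgrad : IsUnbiasedGrad E D F f)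
    (hvar : HasBoundedGradVariance E D F f σ) (hfstar : ∀ x, fstar ≤ f x)
    (hB : 0 < B) (hb : 0 < b) (hη : 0 < η) (hp₀ : 0 < p) (hp₁ : p ≤ 1)
    (hstep : (1 - p) / (p * b) * (L * η) ^ 2 + L * η ≤ 1) (hK : 0 < K) (x₀ : M) :
    ∫⁻ q : Fin K × ((Fin B → Ξ) × (Fin K → StepSample Ξ B b)),
        ‖grad (E := E) f (iterates (E := E) F η x₀ q.2 q.1.castSucc).proj‖ₑ ^ 2
        ∂((ProbabilityTheory.uniformOn Set.univ).prod (runLaw D B b p K))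
      ≤ ENNReal.ofReal (2 * (f x₀ - fstar) / (η * K) + (1 / (p * K) + 1) * (σ ^ 2 / B)) := by
  have hK' : (0 : ℝ) < K := Nat.cast_pos.2 hK
  have hη₂ : 0 < η / 2 := half_pos hη
  have hsum := lintegral_sum_grad_iterates_sq_le (K := K) hM hsmooth hquad hgrad hvar hfstar hB hb
    hη hp₀ hp₁ hstep x₀
  rw [ENNReal.mul_le_iff_le_inv (ENNReal.ofReal_pos.2 hη₂).ne' ENNReal.ofReal_ne_top,
    ← ENNReal.ofReal_inv_of_pos hη₂, ← ENNReal.ofReal_mul (inv_nonneg.2 hη₂.le)] at hsum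
  have huniform := lintegral_uniformOn_prod_le (ι := Fin K) (runLaw D B b p K)
    fun (i : Fin K) (r : (Fin B → Ξ) × (Fin K → StepSample Ξ B b)) =>
      ‖grad (E := E) f (iterates (E := E) F η x₀ r i.castSucc).proj‖ₑ ^ 2
  refine huniform.trans ?_
  grw [hsum]
  rw [Fintype.card_fin, ← ENNReal.ofReal_natCast, ← ENNReal.ofReal_inv_of_pos hK',
    ← ENNReal.ofReal_mul (inv_nonneg.2 hK'.le)]
  refine ENNReal.ofReal_le_ofReal (le_of_eq ?_)
  field_simp
  ring

end Convergence

section Parameters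

variable {δ σ ε η p L B b K : ℝ}

lemma stepsize_condition {r : ℝ} (hL : 0 < L) (hr : 0 ≤ r) (hη : η = 1 / (L * (1 + √r))) :
    r * (L * η) ^ 2 + L * η ≤ 1 := by
  have hLη : L * η = 1 / (1 + √r) := by
    rw [hη]
    field_simp
  calc r * (L * η) ^ 2 + L * η = (r + (1 + √r)) / (1 + √r) ^ 2 := by
        rw [hLη]
        field_simp
    _ ≤ 1 := (div_le_one (by positivity)).2 (by
        linarith [add_sq 1 √r, Real.sq_sqrt hr, Real.sqrt_nonneg r])

lemma stationarity_budget (hε : 0 < ε) (hη : 0 < η) (hp : 0 < p) (hB₀ : 0 < B)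
    (hB : 2 * σ ^ 2 / ε ^ 2 ≤ B) (hK₀ : 0 < K) (hK : 4 * δ / (ε ^ 2 * η) + 1 / p ≤ K) :
    2 * δ / (η * K) + (1 / (p * K) + 1) * (σ ^ 2 / B) ≤ ε ^ 2 := by
  have hvar : σ ^ 2 / B ≤ ε ^ 2 / 2 := by
    rw [div_le_iff₀ (by positivity)] at hB ⊢
    linarith
  calc 2 * δ / (η * K) + (1 / (p * K) + 1) * (σ ^ 2 / B)
      ≤ 2 * δ / (η * K) + (1 / (p * K) + 1) * (ε ^ 2 / 2) := by gcongr
    _ = ε ^ 2 / (2 * K) * (4 * δ / (ε ^ 2 * η) + 1 / p) + ε ^ 2 / 2 := by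
        field_simp
        ring
    _ ≤ ε ^ 2 / (2 * K) * K + ε ^ 2 / 2 := by gcongr
    _ = ε ^ 2 := by
        field_simp
        ring

lemma expected_step_cost_eq (hBb : B + b ≠ 0) (hp : p = b / (B + b)) :
    p * B + (1 - p) * (2 * b) = 3 * (p * B) := by
  rw [hp]
  field_simp
  ring

lemma sqrt_one_sub_div_mul_eq (hB : 0 < B) (hb : 0 < b) (hp : p = b / (B + b)) :
    √((1 - p) / (p * b)) = √B / b := by
  have hsq : (1 - p) / (p * b) = (√B / b) ^ 2 := by
    rw [div_pow, Real.sq_sqrt hB.le, hp]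
    field_simp
    ring
  rw [hsq, Real.sqrt_sq (by positivity)]

lemma inv_stepsize_mul_le (hL : 0 < L) (hB : 0 < B) (hb : 0 < b) (hbB : b ≤ √B)
    (hp : p = b / (B + b)) (hη : η = 1 / (L * (1 + √((1 - p) / (p * b))))) :
    1 / η * (p * B) ≤ 2 * L * √B := by
  have hpB : p * B ≤ b := by
    rw [hp, div_mul_eq_mul_div, div_le_iff₀ (by positivity)]
    gcongr
    linarith
  rw [hη, one_div_one_div, sqrt_one_sub_div_mul_eq hB hb hp]
  calc L * (1 + √B / b) * (p * B) ≤ L * (1 + √B / b) * b := by gcongr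
    _ = L * (b + √B) := by field_simp
    _ ≤ L * (√B + √B) := by gcongr
    _ = 2 * L * √B := by ring

lemma iterations_mul_le (hδ : 0 ≤ δ) (hL : 0 < L) (hε : 0 < ε) (hB : 0 < B) (hb : 0 < b)
    (hbB : b ≤ √B) (hp : p = b / (B + b)) (hη : η = 1 / (L * (1 + √((1 - p) / (p * b)))))
    (hK : K ≤ 4 * δ / (ε ^ 2 * η) + 1 / p + 1) :
    K * (p * B) ≤ 8 * L * δ * √B / ε ^ 2 + 2 * B := by
  have hp₀ : 0 < p := by rw [hp]; positivity
  have hη₀ : 0 < η := by rw [hη]; positivity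
  have hp₁ : p ≤ 1 := by rw [hp]; exact (div_le_one (by positivity)).2 (by linarith)
  calc K * (p * B) ≤ (4 * δ / (ε ^ 2 * η) + 1 / p + 1) * (p * B) := by gcongr
    _ = 4 * δ / ε ^ 2 * (1 / η * (p * B)) + B + p * B := by field_simp
    _ ≤ 4 * δ / ε ^ 2 * (2 * L * √B) + B + 1 * B := by
        grw [inv_stepsize_mul_le hL hB hb hbB hp hη, hp₁]
    _ = 8 * L * δ * √B / ε ^ 2 + 2 * B := by ring

lemma gradCount_budget (hδ : 0 ≤ δ) (hL : 0 < L) (hε : 0 < ε) (hεσ : ε ≤ σ) (hB₀ : 0 < B)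
    (hB : B ≤ 2 * σ ^ 2 / ε ^ 2 + 1) (hb : 0 < b) (hbB : b ≤ √B) (hp : p = b / (B + b))
    (hη : η = 1 / (L * (1 + √((1 - p) / (p * b)))))
    (hK : K ≤ 4 * δ / (ε ^ 2 * η) + 1 / p + 1) :
    B + K * (p * B + (1 - p) * (2 * b)) ≤ 50 * (σ ^ 2 / ε ^ 2 + L * δ * σ / ε ^ 3) := by
  have hone : 1 ≤ σ ^ 2 / ε ^ 2 := (one_le_div (by positivity)).2 (by gcongr)
  have hBle : B ≤ 3 * (σ ^ 2 / ε ^ 2) := by linarith [mul_div_assoc 2 (σ ^ 2) (ε ^ 2)]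
  have hsqrtB : √B ≤ 2 * (σ / ε) := by
    refine Real.sqrt_le_iff.2 ⟨by linarith [div_nonneg (hε.le.trans hεσ) hε.le], ?_⟩
    rw [mul_pow, div_pow]
    linarith
  calc B + K * (p * B + (1 - p) * (2 * b)) = B + 3 * (K * (p * B)) := by
        rw [expected_step_cost_eq (by positivity) hp]
        ring
    _ ≤ B + 3 * (8 * L * δ * √B / ε ^ 2 + 2 * B) := by
        grw [iterations_mul_le hδ hL hε hB₀ hb hbB hp hη hK]
    _ ≤ 3 * (σ ^ 2 / ε ^ 2)
          + 3 * (8 * L * δ * (2 * (σ / ε)) / ε ^ 2 + 2 * (3 * (σ ^ 2 / ε ^ 2))) := by gcongr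
    _ = 21 * (σ ^ 2 / ε ^ 2) + 48 * (L * δ * σ / ε ^ 3) := by
        field_simp
        ring
    _ ≤ 50 * (σ ^ 2 / ε ^ 2 + L * δ * σ / ε ^ 3) := by
        have : 0 ≤ L * δ * σ / ε ^ 3 := by
          have := hε.trans_le hεσ
          positivity
        linarith

end Parameters

end RPAGE

end

open RPAGE in
theorem corollary9_general
    {E : Type*} [NormedAddCommGroup E] [NormedSpace ℝ E] [FiniteDimensional ℝ E]
    {M : Type*} [TopologicalSpace M] [ChartedSpace E M] [IsManifold 𝓘(ℝ, E) ∞ M]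
    [RiemannianBundle (fun x : M => TangentSpace 𝓘(ℝ, E) x)]
    [IsContMDiffRiemannianBundle 𝓘(ℝ, E) ∞ E (fun x : M => TangentSpace 𝓘(ℝ, E) x)]
    (hM : GeodesicallyComplete E M)
    {Ξ : Type*} [MeasurableSpace Ξ] {D : Measure Ξ} [IsProbabilityMeasure D]
    {F : M → Ξ → ℝ} {f : M → ℝ}
    (hF : ∀ x, Integrable (F x) D) (hf : ∀ x, f x = ∫ ξ, F x ξ ∂D)
    {L : ℝ} (hL : 0 < L) (hsmooth : ∀ ξ, IsGeodesicallySmooth E L (fun x => F x ξ))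
    (hgrad : IsUnbiasedGrad E D F f) {σ : ℝ} (hσ : 0 < σ)
    (hvar : HasBoundedGradVariance E D F f σ)
    {fstar : ℝ} (hfstar : ∀ x, fstar ≤ f x) (x₀ : M) {ε : ℝ} (hε : 0 < ε)
    {B : ℕ} (hB : B = ⌈2 * σ ^ 2 / ε ^ 2⌉₊) {b : ℕ} (hb : 0 < b)
    {p : ℝ} (hp₀ : 0 < p) (hp₁ : p ≤ 1) {η : ℝ} (hη : η = 1 / (L * (1 + √((1 - p) / (p * b)))))
    {K : ℕ} (hK : K = ⌈4 * (f x₀ - fstar) / (ε ^ 2 * η) + 1 / p⌉₊) :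
    (∫⁻ q : Fin K × ((Fin B → Ξ) × (Fin K → StepSample Ξ B b)),
        ‖grad (E := E) f (iterates (E := E) F η x₀ q.2 q.1.castSucc).proj‖ₑ ^ 2
        ∂((ProbabilityTheory.uniformOn Set.univ).prod (runLaw D B b p K))
      ≤ ENNReal.ofReal (ε ^ 2)) ∧
    (∫⁻ q : Fin K × ((Fin B → Ξ) × (Fin K → StepSample Ξ B b)),
        ‖grad (E := E) f (iterates (E := E) F η x₀ q.2 q.1.castSucc).proj‖ₑ
        ∂((ProbabilityTheory.uniformOn Set.univ).prod (runLaw D B b p K))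
      ≤ ENNReal.ofReal ε) ∧
    ((b : ℝ) ≤ √B → p = b / (B + b) → ε ≤ σ →
      ∫⁻ r, (gradCount r : ENNReal) ∂(runLaw D B b p K)
        ≤ ENNReal.ofReal (50 * (σ ^ 2 / ε ^ 2 + L * (f x₀ - fstar) * σ / ε ^ 3))) := by
  have hδ : 0 ≤ f x₀ - fstar := sub_nonneg.2 (hfstar x₀)
  have hη₀ : 0 < η := by rw [hη]; positivity
  have hB₀ : 0 < B := by rw [hB]; exact Nat.ceil_pos.2 (by positivity)
  have hK₀ : 0 < K := by rw [hK]; exact Nat.ceil_pos.2 (by positivity)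
  have hquad := HasQuadraticUpperBound.integral (fun ξ => (hsmooth ξ).hasQuadraticUpperBound hM)
    hF hf hgrad
  have hstep := stepsize_condition hL
    (div_nonneg (sub_nonneg.2 hp₁) (mul_nonneg hp₀.le b.cast_nonneg)) hη
  have hsq := (lintegral_grad_uniform_iterate_sq_le hM hsmooth hquad hgrad hvar hfstar hB₀ hb hη₀
    hp₀ hp₁ hstep hK₀ x₀).trans <| ENNReal.ofReal_le_ofReal <|
      stationarity_budget hε hη₀ hp₀ (Nat.cast_pos.2 hB₀) (hB ▸ Nat.le_ceil _)
        (Nat.cast_pos.2 hK₀) (hK ▸ Nat.le_ceil _)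
  refine ⟨hsq, ?_, fun hbB hp hεσ => ?_⟩
  · have : Nonempty (Fin K) := ⟨⟨0, hK₀⟩⟩
    have := ProbabilityTheory.isProbabilityMeasure_uniformOn (Ω := Fin K) Set.finite_univ
      Set.univ_nonempty
    have := isProbabilityMeasure_runLaw (D := D) (B := B) (b := b) (K := K) hp₀.le hp₁
    rw [← ENNReal.pow_le_pow_left_iff two_ne_zero, ← ENNReal.ofReal_pow hε.le]
    exact (sq_lintegral_le_lintegral_sq _).trans hsq
  · exact (lintegral_gradCount_le hp₀.le hp₁).trans <| ENNReal.ofReal_le_ofReal <|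
      gradCount_budget hδ hL hε hεσ (Nat.cast_pos.2 hB₀)
        (hB ▸ (Nat.ceil_lt_add_one (by positivity)).le) (Nat.cast_pos.2 hb) hbB hp hη
        (hK ▸ (Nat.ceil_lt_add_one (by positivity)).le)

theorem corollary9
    -- a geodesically complete smooth Riemannian manifold
    {E : Type*} [NormedAddCommGroup E] [NormedSpace ℝ E] [FiniteDimensional ℝ E]
    {M : Type*} [TopologicalSpace M] [T2Space M] [SecondCountableTopology M]
    [ChartedSpace E M] [IsManifold 𝓘(ℝ, E) ∞ M]
    [RiemannianBundle (fun x : M => TangentSpace 𝓘(ℝ, E) x)]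
    [IsContMDiffRiemannianBundle 𝓘(ℝ, E) ∞ E (fun x : M => TangentSpace 𝓘(ℝ, E) x)]
    (hM : RPAGE.GeodesicallyComplete E M)
    -- the online problem: minimize `f x = 𝔼 [F x ξ]`, `ξ ∼ D`
    {Ξ : Type*} [MeasurableSpace Ξ] (D : Measure Ξ) [IsProbabilityMeasure D]
    (F : M → Ξ → ℝ) (f : M → ℝ)
    (hF : ∀ x, Integrable (F x) D) (hf : ∀ x, f x = ∫ ξ, F x ξ ∂D)
    (hfd : MDifferentiable 𝓘(ℝ, E) 𝓘(ℝ, ℝ) f)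
    -- geodesic smoothness of every `F · ξ`
    (L : ℝ) (hL : 0 < L)
    (hsmooth : ∀ ξ, RPAGE.IsGeodesicallySmooth E L (fun x => F x ξ))
    -- unbiasedness
    (hint : ∀ x, Integrable (fun ξ => RPAGE.grad (E := E) (fun y => F y ξ) x) D)
    (hunb : ∀ x, ∫ ξ, RPAGE.grad (E := E) (fun y => F y ξ) x ∂D = RPAGE.grad f x)
    -- bounded variance
    (σ : ℝ) (hσ : 0 < σ)
    (hvar : ∀ x, ∫⁻ ξ, ‖RPAGE.grad (E := E) (fun y => F y ξ) x - RPAGE.grad f x‖ₑ ^ 2 ∂D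
      ≤ ENNReal.ofReal (σ ^ 2))
    -- uniform lower bound, initial point
    (fstar : ℝ) (hfstar : ∀ x, fstar ≤ f x) (x₀ : M)
    -- parameters
    (ε : ℝ) (hε : 0 < ε)
    (B : ℕ) (hB : B = ⌈2 * σ ^ 2 / ε ^ 2⌉₊)
    (b : ℕ) (hb : 1 ≤ b) (hbB : (b : ℝ) ≤ √(B : ℝ))
    (p : ℝ) (hp : p = b / (B + b))
    (η : ℝ) (hη : η = 1 / (L * (1 + √((1 - p) / (p * b)))))
    (K : ℕ) (hK : K = ⌈4 * (f x₀ - fstar) / (ε ^ 2 * η) + 1 / p⌉₊) :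
    -- the output, uniformly random among `x^0, …, x^{K-1}`, is `ε`-stationary in expectation
    (∫⁻ q : Fin K × ((Fin B → Ξ) × (Fin K → RPAGE.StepSample Ξ B b)),
        ‖RPAGE.grad (E := E) f (RPAGE.iterates (E := E) F η x₀ q.2 q.1.castSucc).proj‖ₑ ^ 2
        ∂((ProbabilityTheory.uniformOn Set.univ).prod (RPAGE.runLaw D B b p K))
      ≤ ENNReal.ofReal (ε ^ 2)) ∧
    (∫⁻ q : Fin K × ((Fin B → Ξ) × (Fin K → RPAGE.StepSample Ξ B b)),
        ‖RPAGE.grad (E := E) f (RPAGE.iterates (E := E) F η x₀ q.2 q.1.castSucc).proj‖ₑ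
        ∂((ProbabilityTheory.uniformOn Set.univ).prod (RPAGE.runLaw D B b p K))
      ≤ ENNReal.ofReal ε) ∧
    -- the expected number of stochastic gradient computations
    (ε ≤ σ →
      ∫⁻ r, (RPAGE.gradCount r : ENNReal) ∂(RPAGE.runLaw D B b p K)
        ≤ ENNReal.ofReal (50 * (σ ^ 2 / ε ^ 2 + L * (f x₀ - fstar) * σ / ε ^ 3))) := by
  have hB₀ : 0 < B := by rw [hB]; exact Nat.ceil_pos.2 (by positivity)
  have hp₁ : p ≤ 1 := by rw [hp]; exact (div_le_one (by positivity)).2 (by simp)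
  have h := corollary9_general hM hF hf hL hsmooth ⟨hint, hunb⟩ hσ hvar hfstar x₀ hε hB hb
    (by rw [hp]; positivity) hp₁ hη hK
  exact ⟨h.1, h.2.1, h.2.2 hbB hp⟩
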